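/- Let $F$ be Thompson's group of all increasing piecewise linear homeomorphisms of $[0,1]$ with finitely many breakpoints, all of them dyadic rationals, and with all slopes integer powers of $2$. Let $x_0,x_1\in F$ be its standard generators, $$x_0(t)=\begin{cases}t/2,&0\le t\le \frac12\\ t-\frac14,&\frac12\le t\le\frac34\\ 2t-1,&\frac34\le t\le 1\end{cases}\qquad x_1(t)=\begin{cases}t,&0\le t\le\frac12\\ \frac t2+\frac14,&\frac12\le t\le\frac34\\ t-\frac18,&\frac34\le t\le\frac78\\ 2t-1,&\frac78\le t\le1.\end{cases}$$ Let $\mathcal T$ be the space of isomorphism classes of connected pointed oriented graphs with arrows labeled by $x_0,x_1$ in which every vertex has, for each label, exactly one outgoing and one incoming arrow. The metric on $\mathcal T$ is $d((\Gamma,x),(\Delta,y))=2^{-n}$, where $n$ is the largest integer such that the balls of radius $n$ around $x$ and $y$ are isomorphic as marked pointed graphs ($d=0$ if all of them are isomorphic; $n=-1$ if already the balls of radius $0$ are not). The Schreier graph $\Gamma$ of the orbit of $\frac12$ has the points of this orbit (the dyadic rationals in $(0,1)$) as vertices and an arrow labeled $x_i$ from $t$ to $x_i(t)$ for all $t$ and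 $i$. Let $\mathcal C\subset\mathcal T$ be the set of all pointed graphs $(\Gamma,q)$, with $q$ any vertex of $\Gamma$ (graphs of type A), and let $\bar{\mathcal C}$ be its closure. For an infinite binary word $w=w_0w_1\ldots$ let $T_w$ be the set of pairs $\tau=(\ell,v)$ with $\ell\in\mathbb Z$ and $v=v_0v_1\ldots\in\{0,1\}^{\mathbb N}$ such that $v_j=w_{\ell+j}$ for all sufficiently large $j$, and put $\tau b=(\ell-1,bv)$ for $b\in\{0,1\}$. (This is a binary tree without a root, in which the infinite path going up from $(0,w)$ turns left or right according to the letters of $w$.) Let $\tilde\Gamma(w)$ be the graph with vertex set $T_w\times\mathbb Z$, where the vertex $((\ell,v),n)$ is thought of as labeled by $0^n1v$ if $n>0$, by $10v$ if $n=0$, and by $1^{1-n}0v$ if $n<0$, and with the following arrows: - $x_0$: $(\tau,n)\to(\tau,n+1)$ for all $n$; - $x_1$: $(\tau,n)\to(\tau,n)$ for $n>0$, $(\tau,0)\to(\tau0,0)$, $(\tau,-1)\to(\tau1,0)$, and $(\tau,n)\to(\tau,n+1)$ for $n\le-2$. The graphs of type B are the pointed graphs $(\tilde\Gamma(w),p)$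 for all infinite binary words $w$ and all vertices $p$ of $\tilde\Gamma(w)$. The graphs of type C are the two pointed graphs with vertex set $\mathbb Z$, base vertex $0$ and arrows $n\to n+1$ labeled $x_0$, in which the arrows labeled $x_1$ are all loops $n\to n$ in the first graph, and are $n\to n+1$ in the second one. **Proposition.** The Cantor–Bendixson rank of $\bar{\mathcal C}$ (the least number of times one has to remove the isolated points from $\bar{\mathcal C}$ to get a set without isolated points) is equal to $1$. The perfect kernel $\mathcal D$ of $\bar{\mathcal C}$ consists exactly of the graphs of type B and of type C, and $\mathcal D$ is homeomorphic to the Cantor set $\{0,1\}^{\mathbb N}$. -/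

import Mathlib

namespace SchreierF

/-! ### Marked graphs and the space of pointed marked graphs -/

/-- A regular marked graph over the label set `{0, 1}`: an oriented graph whose arrows carry labels
(loops and multiple arrows with different labels are allowed), in which every vertex has, for each
label, exactly one outgoing and exactly one incoming arrow. -/
structure MarkedGraph where
  V : Type
  adj : Fin 2 → V → V → Prop
  out_unique : ∀ s x, ∃! y, adj s x y
  in_unique : ∀ s y, ∃! x, adj s x y

/-- `x` and `y` are joined by an arrow, in one direction or the other. -/
def MarkedGraph.Link (G : MarkedGraph) (x y : G.V) : Prop :=
  ∃ s, G.adj s x y ∨ G.adj s y x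

/-- Any two vertices are joined by an unoriented path. -/
def MarkedGraph.Connected (G : MarkedGraph) : Prop :=
  ∀ x y, Relation.ReflTransGen G.Link x y

/-- A connected regular marked graph with a selected vertex. -/
structure PointedGraph extends MarkedGraph where
  connected : toMarkedGraph.Connected
  base : V

namespace PointedGraph

/-- The set of vertices at (unoriented) distance at most `n` from the base vertex. -/
def ball (Γ : PointedGraph) : ℕ → Set Γ.V
  | 0 => {Γ.base}
  | n + 1 => ball Γ n ∪ {y | ∃ x ∈ ball Γ n, Γ.Link x y}

/-- Isomorphism of pointed marked graphs. -/
def Iso (Γ Δ : PointedGraph) : Prop :=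
  ∃ e : Γ.V ≃ Δ.V, e Γ.base = Δ.base ∧ ∀ s x y, Γ.adj s x y ↔ Δ.adj s (e x) (e y)

/-- The balls of radius `n` around the base vertices are isomorphic as pointed marked graphs. -/
def BallIso (n : ℕ) (Γ Δ : PointedGraph) : Prop :=
  ∃ e : Γ.ball n ≃ Δ.ball n, (∀ x, x.1 = Γ.base → (e x).1 = Δ.base) ∧
    ∀ s x y, Γ.adj s x.1 y.1 ↔ Δ.adj s (e x).1 (e y).1

theorem Iso.refl (Γ : PointedGraph) : Iso Γ Γ := ⟨Equiv.refl _, rfl, fun _ _ _ => Iff.rfl⟩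

theorem Iso.symm {Γ Δ : PointedGraph} : Iso Γ Δ → Iso Δ Γ := by
  rintro ⟨e, hb, he⟩
  exact ⟨e.symm, by rw [← hb]; simp, fun s x y => by simp [he]⟩

theorem Iso.trans {Γ Δ Θ : PointedGraph} : Iso Γ Δ → Iso Δ Θ → Iso Γ Θ := by
  rintro ⟨e, hb, he⟩ ⟨f, hf, hf'⟩
  exact ⟨e.trans f, by simp [hb, hf], fun s x y => by simp [he, hf']⟩

instance setoid : Setoid PointedGraph where
  r := Iso
  iseqv := ⟨Iso.refl, Iso.symm, Iso.trans⟩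

theorem base_mem (Γ : PointedGraph) (n : ℕ) : Γ.base ∈ Γ.ball n := by
  induction n with
  | zero => rfl
  | succ n ih => exact Or.inl ih

theorem ball_mono (Γ : PointedGraph) {m n : ℕ} (h : m ≤ n) : Γ.ball m ⊆ Γ.ball n := by
  induction h with
  | refl => exact subset_rfl
  | step _ ih => exact ih.trans Set.subset_union_left

theorem BallIso.symm {n : ℕ} {Γ Δ : PointedGraph} : BallIso n Γ Δ → BallIso n Δ Γ := by
  rintro ⟨e, hb, he⟩
  refine ⟨e.symm, ?_, fun s x y => by simp [he]⟩
  intro x hx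
  have h1 : e ⟨Γ.base, Γ.base_mem n⟩ = x := Subtype.ext ((hb _ rfl).trans hx.symm)
  rw [← h1]; simp

theorem BallIso.trans {n : ℕ} {Γ Δ Θ : PointedGraph} :
    BallIso n Γ Δ → BallIso n Δ Θ → BallIso n Γ Θ := by
  rintro ⟨e, hb, he⟩ ⟨f, hf, hf'⟩
  exact ⟨e.trans f, fun x hx => by simpa using hf _ (hb x hx), fun s x y => by simp [he, hf']⟩

/-- A map between balls preserving base and arrows sends smaller balls into smaller balls. -/
theorem map_mem_ball {n : ℕ} {Γ Δ : PointedGraph} (e : Γ.ball n → Δ.ball n)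
    (hb : ∀ x, x.1 = Γ.base → (e x).1 = Δ.base)
    (he : ∀ s x y, Γ.adj s x.1 y.1 → Δ.adj s (e x).1 (e y).1) (m : ℕ) (hm : m ≤ n)
    (x : Γ.ball n) (hx : x.1 ∈ Γ.ball m) : (e x).1 ∈ Δ.ball m := by
  induction m generalizing x with
  | zero => exact hb x hx
  | succ m ih =>
    rcases hx with hx | ⟨y, hy, s, h⟩
    · exact Or.inl (ih (by omega) x hx)
    · refine Or.inr ⟨_, ih (by omega) ⟨y, Γ.ball_mono (by omega) hy⟩ hy, s, ?_⟩
      exact h.imp (he s ⟨y, _⟩ x) (he s x ⟨y, _⟩)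

theorem BallIso.mono {m n : ℕ} (hm : m ≤ n) {Γ Δ : PointedGraph} :
    BallIso n Γ Δ → BallIso m Γ Δ := by
  intro h
  obtain ⟨e, hb, he⟩ := h
  obtain ⟨hb', he'⟩ : (∀ x, x.1 = Δ.base → (e.symm x).1 = Γ.base) ∧
      ∀ s x y, Δ.adj s x.1 y.1 → Γ.adj s (e.symm x).1 (e.symm y).1 := by
    refine ⟨fun x hx => ?_, fun s x y => by simp [he]⟩
    have h1 : e ⟨Γ.base, Γ.base_mem n⟩ = x := Subtype.ext ((hb _ rfl).trans hx.symm)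
    rw [← h1]; simp
  refine ⟨⟨fun x => ⟨(e ⟨x.1, Γ.ball_mono hm x.2⟩).1,
      map_mem_ball e hb (fun s x y => (he s x y).1) m hm _ x.2⟩,
    fun x => ⟨(e.symm ⟨x.1, Δ.ball_mono hm x.2⟩).1,
      map_mem_ball e.symm hb' he' m hm _ x.2⟩, fun x => by simp, fun x => by simp⟩, ?_, ?_⟩
  · intro x hx; exact hb _ hx
  · intro s x y; exact he s ⟨x.1, _⟩ ⟨y.1, _⟩

theorem Iso.mem_ball {Γ Δ : PointedGraph} (e : Γ.V ≃ Δ.V) (hb : e Γ.base = Δ.base)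
    (he : ∀ s x y, Γ.adj s x y ↔ Δ.adj s (e x) (e y)) (n : ℕ) (x : Γ.V) :
    x ∈ Γ.ball n ↔ e x ∈ Δ.ball n := by
  induction n generalizing x with
  | zero => simp [ball, ← hb]
  | succ n ih =>
    refine or_congr (ih x) ?_
    constructor
    · rintro ⟨y, hy, s, h⟩
      exact ⟨e y, (ih y).1 hy, s, h.imp (he _ _ _).1 (he _ _ _).1⟩
    · rintro ⟨y, hy, s, h⟩
      refine ⟨e.symm y, (ih _).2 (by simpa using hy), s, ?_⟩
      simpa [he] using h

theorem Iso.ballIso {Γ Δ : PointedGraph} (h : Iso Γ Δ) (n : ℕ) : BallIso n Γ Δ := by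
  obtain ⟨e, hb, he⟩ := h
  exact ⟨e.subtypeEquiv (Iso.mem_ball e hb he n), fun x hx => by simp [hx, hb],
    fun s x y => he s _ _⟩

theorem exists_mem_ball (Γ : PointedGraph) (x : Γ.V) : ∃ n, x ∈ Γ.ball n := by
  induction Γ.connected Γ.base x with
  | refl => exact ⟨0, rfl⟩
  | tail _ h ih =>
    obtain ⟨n, hn⟩ := ih
    exact ⟨n + 1, Or.inr ⟨_, hn, h⟩⟩

/-- Isomorphisms of balls are unique, on common subballs. -/
theorem ball_unique {m n : ℕ} {Γ Δ : PointedGraph}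
    (e : Γ.ball m → Δ.ball m) (f : Γ.ball n → Δ.ball n)
    (hbe : ∀ x, x.1 = Γ.base → (e x).1 = Δ.base) (hbf : ∀ x, x.1 = Γ.base → (f x).1 = Δ.base)
    (he : ∀ s x y, Γ.adj s x.1 y.1 → Δ.adj s (e x).1 (e y).1)
    (hf : ∀ s x y, Γ.adj s x.1 y.1 → Δ.adj s (f x).1 (f y).1)
    (k : ℕ) (hm : k ≤ m) (hn : k ≤ n) (x : Γ.V) (hx : x ∈ Γ.ball k) :
    (e ⟨x, Γ.ball_mono hm hx⟩).1 = (f ⟨x, Γ.ball_mono hn hx⟩).1 := by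
  induction k generalizing x with
  | zero =>
    have hx' : x = Γ.base := hx
    rw [hbe ⟨x, _⟩ hx', hbf ⟨x, _⟩ hx']
  | succ k ih =>
    rcases hx with hx | ⟨y, hy, s, h⟩
    · exact ih (by omega) (by omega) x hx
    · have hxy := ih (by omega) (by omega) y hy
      have hxm : x ∈ Γ.ball m := Γ.ball_mono hm (Or.inr ⟨y, hy, s, h⟩)
      have hxn : x ∈ Γ.ball n := Γ.ball_mono hn (Or.inr ⟨y, hy, s, h⟩)
      have hym : y ∈ Γ.ball m := Γ.ball_mono (by omega) hy
      have hyn : y ∈ Γ.ball n := Γ.ball_mono (by omega) hy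
      rcases h with h | h
      · have h1 := he s ⟨y, hym⟩ ⟨x, hxm⟩ h
        have h2 := hf s ⟨y, hyn⟩ ⟨x, hxn⟩ h
        rw [← hxy] at h2
        exact (Δ.out_unique s _).unique h1 h2
      · have h1 := he s ⟨x, hxm⟩ ⟨y, hym⟩ h
        have h2 := hf s ⟨x, hxn⟩ ⟨y, hyn⟩ h
        rw [← hxy] at h2
        exact (Δ.in_unique s _).unique h1 h2

theorem exists_hom {Γ Δ : PointedGraph} (h : ∀ n, BallIso n Γ Δ) :
    ∃ φ : Γ.V → Δ.V, φ Γ.base = Δ.base ∧ ∀ s x y, Γ.adj s x y → Δ.adj s (φ x) (φ y) := by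
  choose e hb he using h
  choose r hr using Γ.exists_mem_ball
  have key : ∀ x n (hx : x ∈ Γ.ball n), (e (r x) ⟨x, hr x⟩).1 = (e n ⟨x, hx⟩).1 := by
    intro x n hx
    rcases le_total (r x) n with h | h
    · exact ball_unique (e (r x)) (e n) (hb _) (hb _) (fun s x y => (he _ s x y).1)
        (fun s x y => (he _ s x y).1) (r x) le_rfl h x (hr x)
    · exact ball_unique (e (r x)) (e n) (hb _) (hb _) (fun s x y => (he _ s x y).1)
        (fun s x y => (he _ s x y).1) n h le_rfl x hx
  refine ⟨fun x => (e (r x) ⟨x, hr x⟩).1, hb _ _ rfl, fun s x y hxy => ?_⟩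
  have hx := Γ.ball_mono (le_max_left (r x) (r y)) (hr x)
  have hy := Γ.ball_mono (le_max_right (r x) (r y)) (hr y)
  change Δ.adj s (e (r x) ⟨x, hr x⟩).1 (e (r y) ⟨y, hr y⟩).1
  rw [key x _ hx, key y _ hy]
  exact (he _ s ⟨x, hx⟩ ⟨y, hy⟩).1 hxy

theorem hom_eq_id {Γ : PointedGraph} (φ : Γ.V → Γ.V) (hb : φ Γ.base = Γ.base)
    (h : ∀ s x y, Γ.adj s x y → Γ.adj s (φ x) (φ y)) (x : Γ.V) : φ x = x := by
  induction Γ.connected Γ.base x with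
  | refl => exact hb
  | tail _ hl ih =>
    obtain ⟨s, hl | hl⟩ := hl
    · have := h _ _ _ hl
      rw [ih] at this
      exact (Γ.out_unique s _).unique this hl
    · have := h _ _ _ hl
      rw [ih] at this
      exact (Γ.in_unique s _).unique this hl

theorem iso_of_ballIso {Γ Δ : PointedGraph} (h : ∀ n, BallIso n Γ Δ) : Iso Γ Δ := by
  obtain ⟨φ, hφ, hφ'⟩ := exists_hom h
  obtain ⟨ψ, hψ, hψ'⟩ := exists_hom (fun n => (h n).symm)
  have h1 : ∀ x, ψ (φ x) = x := hom_eq_id (fun x => ψ (φ x)) (by rw [hφ, hψ])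
    (fun s x y hxy => hψ' _ _ _ (hφ' _ _ _ hxy))
  have h2 : ∀ x, φ (ψ x) = x := hom_eq_id (fun x => φ (ψ x)) (by rw [hψ, hφ])
    (fun s x y hxy => hφ' _ _ _ (hψ' _ _ _ hxy))
  refine ⟨⟨φ, ψ, h1, h2⟩, hφ, fun s x y => ⟨hφ' s x y, fun hxy => ?_⟩⟩
  have := hψ' _ _ _ hxy
  simpa [h1] using this

end PointedGraph

/-- The space of pointed marked graphs: connected regular marked graphs with a selected vertex, up
to isomorphism. -/
def GraphSpace : Type 1 := Quotient PointedGraph.setoid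

namespace GraphSpace

def mk (Γ : PointedGraph) : GraphSpace := Quotient.mk _ Γ

/-- The balls of radius `n` of two elements of the space are isomorphic. -/
def BallIso (n : ℕ) : GraphSpace → GraphSpace → Prop :=
  Quotient.lift₂ (PointedGraph.BallIso n) (by
    intro a b c d hac hbd
    have h1 := PointedGraph.Iso.ballIso hac n
    have h2 := PointedGraph.Iso.ballIso hbd n
    exact propext ⟨fun h => (h1.symm.trans h).trans h2, fun h => (h1.trans h).trans h2.symm⟩)

theorem BallIso.refl (n : ℕ) (a : GraphSpace) : BallIso n a a := by
  induction a using Quotient.inductionOn with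
  | h Γ => exact PointedGraph.Iso.ballIso (PointedGraph.Iso.refl Γ) n

theorem BallIso.symm {n : ℕ} {a b : GraphSpace} : BallIso n a b → BallIso n b a := by
  induction a, b using Quotient.inductionOn₂ with
  | h Γ Δ => exact PointedGraph.BallIso.symm

theorem BallIso.trans {n : ℕ} {a b c : GraphSpace} :
    BallIso n a b → BallIso n b c → BallIso n a c := by
  induction a, b, c using Quotient.inductionOn₃ with
  | h Γ Δ Θ => exact PointedGraph.BallIso.trans

theorem BallIso.mono {m n : ℕ} (hm : m ≤ n) {a b : GraphSpace} :
    BallIso n a b → BallIso m a b := by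
  induction a, b using Quotient.inductionOn₂ with
  | h Γ Δ => exact PointedGraph.BallIso.mono hm

theorem eq_of_ballIso {a b : GraphSpace} : (∀ n, BallIso n a b) → a = b := by
  induction a, b using Quotient.inductionOn₂ with
  | h Γ Δ => exact fun h => Quotient.sound (PointedGraph.iso_of_ballIso h)

open Classical in
/-- The distance `2 ^ (-n)`, where `n` is the largest integer such that the balls of radius `n` are
isomorphic, that is, where `n + 1` is the least radius for which they are not isomorphic (so `n` is
`-1` if already the balls of radius `0`, a vertex with its loops, differ), and `0` if the balls of
every radius are isomorphic. -/
noncomputable instance : Dist GraphSpace where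
  dist a b := if h : ∃ n, ¬ BallIso n a b then 2 * (1 / 2 : ℝ) ^ Nat.find h else 0

theorem dist_le_iff (a b : GraphSpace) (n : ℕ) :
    dist a b ≤ (1 / 2 : ℝ) ^ n ↔ BallIso n a b := by
  classical
  simp only [dist]
  split_ifs with h
  · have h3 : 2 * (1 / 2 : ℝ) ^ Nat.find h ≤ (1 / 2 : ℝ) ^ n ↔ n + 1 ≤ Nat.find h := by
      rw [← pow_le_pow_iff_right_of_lt_one₀ (a := (1 / 2 : ℝ)) (by norm_num) (by norm_num),
        pow_succ (1 / 2 : ℝ) n]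
      constructor <;> intro h <;> linarith
    rw [h3, Nat.succ_le_iff, Nat.lt_find_iff]
    refine ⟨fun h4 => not_not.1 (h4 n le_rfl), fun h4 m hm => not_not.2 (h4.mono hm)⟩
  · push Not at h
    exact ⟨fun _ => h n, fun _ => by positivity⟩

theorem dist_mem (a b : GraphSpace) :
    dist a b = 0 ∨ dist a b = 2 ∨ ∃ n : ℕ, dist a b = (1 / 2 : ℝ) ^ n := by
  classical
  simp only [dist]
  split_ifs with h
  · right
    rcases Nat.find h with _ | n
    · left; simp
    · right; exact ⟨n, by rw [pow_succ]; ring⟩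
  · simp

theorem dist_nonneg' (a b : GraphSpace) : 0 ≤ dist a b := by
  rcases dist_mem a b with h | h | ⟨n, h⟩ <;> rw [h] <;> positivity

theorem dist_le_two (a b : GraphSpace) : dist a b ≤ 2 := by
  rcases dist_mem a b with h | h | ⟨n, h⟩ <;> rw [h]
  · norm_num
  · exact (pow_le_one₀ (by norm_num) (by norm_num)).trans (by norm_num)

theorem dist_eq_zero_iff (a b : GraphSpace) : dist a b = 0 ↔ ∀ n, BallIso n a b := by
  constructor
  · intro h n
    rw [← dist_le_iff, h]; positivity
  · intro h
    have h1 : ∀ n : ℕ, dist a b ≤ (1 / 2 : ℝ) ^ n := fun n => (dist_le_iff a b n).2 (h n)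
    refine le_antisymm (ge_of_tendsto' (tendsto_pow_atTop_nhds_zero_of_lt_one
      (by norm_num : (0 : ℝ) ≤ 1 / 2) (by norm_num)) h1) (dist_nonneg' a b)

theorem dist_comm' (a b : GraphSpace) : dist a b = dist b a := by
  classical
  have h : ∀ n, BallIso n a b ↔ BallIso n b a := fun n => ⟨BallIso.symm, BallIso.symm⟩
  simp only [dist, h]

theorem dist_ultra (a b c : GraphSpace) : dist a c ≤ max (dist a b) (dist b c) := by
  wlog hw : dist b c ≤ dist a b generalizing a b c
  · have := this c b a (by rw [dist_comm' b a, dist_comm' c b]; exact (not_le.1 hw).le)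
    rwa [dist_comm' c a, dist_comm' c b, dist_comm' b a, max_comm] at this
  rw [max_eq_left hw]
  rcases dist_mem a b with h | h | ⟨n, h⟩
  · have h2 : dist b c = 0 := le_antisymm (h ▸ hw) (dist_nonneg' _ _)
    rw [dist_eq_zero_iff] at h2
    have h' := (dist_eq_zero_iff a b).1 h
    rw [h]
    exact ((dist_eq_zero_iff a c).2 fun n => (h' n).trans (h2 n)).le
  · rw [h]; exact dist_le_two a c
  · have h1 := (dist_le_iff a b n).1 h.le
    have h2 := (dist_le_iff b c n).1 (h ▸ hw)
    rw [h]
    exact (dist_le_iff a c n).2 (h1.trans h2)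

noncomputable instance : MetricSpace GraphSpace where
  dist_self a := (dist_eq_zero_iff a a).2 fun n => BallIso.refl n a
  dist_comm := dist_comm'
  dist_triangle a b c := (dist_ultra a b c).trans
    (max_le_add_of_nonneg (dist_nonneg' a b) (dist_nonneg' b c))
  eq_of_dist_eq_zero {a b} h := eq_of_ballIso ((dist_eq_zero_iff a b).1 h)

end GraphSpace

/-! ### Thompson's group `F` -/

/-- A dyadic rational number. -/
def IsDyadic (t : ℝ) : Prop := ∃ (k : ℤ) (m : ℕ), t = k / 2 ^ m

theorem IsDyadic.sub {s t : ℝ} : IsDyadic s → IsDyadic t → IsDyadic (s - t) := by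
  rintro ⟨k, m, rfl⟩ ⟨l, n, rfl⟩
  exact ⟨k * 2 ^ n - l * 2 ^ m, m + n, by push_cast; rw [pow_add]; field_simp⟩

theorem IsDyadic.zero : IsDyadic 0 := ⟨0, 0, by simp⟩

theorem IsDyadic.add {s t : ℝ} (hs : IsDyadic s) (ht : IsDyadic t) : IsDyadic (s + t) := by
  simpa using hs.sub (IsDyadic.zero.sub ht)

theorem IsDyadic.zpow_mul {t : ℝ} (k : ℤ) : IsDyadic t → IsDyadic (2 ^ k * t) := by
  rintro ⟨l, m, rfl⟩
  rcases le_total 0 k with hk | hk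
  · lift k to ℕ using hk
    exact ⟨2 ^ k * l, m, by push_cast; rw [zpow_natCast]; ring⟩
  · obtain ⟨n, rfl⟩ := Int.exists_eq_neg_ofNat hk
    exact ⟨l, n + m, by rw [zpow_neg, zpow_natCast, pow_add]; field_simp⟩

/-- A strictly increasing homeomorphism of `[0, 1]` that is piecewise linear, with finitely many
breakpoints, all of them dyadic, and slopes that are integer powers of `2`: it is affine with such a
slope on every interval without breakpoints in its interior. (A strictly increasing bijection of
`[0, 1]` is a homeomorphism.) -/
def IsThompson (f : unitInterval ≃o unitInterval) : Prop :=
  ∃ B : Finset unitInterval, (∀ b ∈ B, IsDyadic b) ∧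
    ∀ a b : unitInterval, a ≤ b → (∀ c ∈ B, ¬ (a < c ∧ c < b)) →
      ∃ (k : ℤ) (r : ℝ), ∀ t : unitInterval, a ≤ t → t ≤ b → (f t : ℝ) = 2 ^ k * (t : ℝ) + r

theorem IsThompson.isDyadic {f : unitInterval ≃o unitInterval} (hf : IsThompson f)
    (t : unitInterval) (ht : IsDyadic t) : IsDyadic (f t) := by
  classical
  obtain ⟨B, hB, h⟩ := hf
  have key : ∀ (n : ℕ) (t : unitInterval), IsDyadic t → (B.filter (· < t)).card = n →
      IsDyadic (f t) := by
    intro n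
    induction n using Nat.strong_induction_on with
    | _ n ih =>
      intro t ht hn
      have h0 : (f 0 : ℝ) = 0 := by
        have : f 0 = 0 := f.map_bot
        rw [this]; rfl
      suffices H : ∃ b : unitInterval, b ≤ t ∧ IsDyadic b ∧ IsDyadic (f b) ∧
          ∀ c ∈ B, ¬ (b < c ∧ c < t) by
        obtain ⟨b, hbt, hb, hfb, hc⟩ := H
        obtain ⟨k, r, hk⟩ := h b t hbt hc
        have h1 := hk b le_rfl hbt
        have h2 := hk t hbt le_rfl
        have : (f t : ℝ) = f b + 2 ^ k * ((t : ℝ) - b) := by rw [h1, h2]; ring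
        rw [this]
        exact hfb.add ((ht.sub hb).zpow_mul k)
      rcases (B.filter (· < t)).eq_empty_or_nonempty with he | hne
      · refine ⟨0, unitInterval.nonneg t, IsDyadic.zero, by rw [h0]; exact IsDyadic.zero, ?_⟩
        intro c hc hct
        have : c ∈ B.filter (· < t) := Finset.mem_filter.2 ⟨hc, hct.2⟩
        simp [he] at this
      · obtain ⟨b, hb, hmax⟩ := (B.filter (· < t)).exists_max_image id hne
        rw [Finset.mem_filter] at hb
        refine ⟨b, hb.2.le, hB b hb.1, ih _ ?_ b (hB b hb.1) rfl, ?_⟩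
        · rw [← hn]
          apply Finset.card_lt_card
          refine ⟨fun c hc => ?_, fun hs => ?_⟩
          · rw [Finset.mem_filter] at hc ⊢
            exact ⟨hc.1, hc.2.trans hb.2⟩
          · have := hs (Finset.mem_filter.2 hb)
            simp at this
        · intro c hc hct
          exact absurd (hmax c (Finset.mem_filter.2 ⟨hc, hct.2⟩)) (not_le.2 hct.1)
  exact key _ t ht rfl

theorem IsThompson.one : IsThompson 1 :=
  ⟨∅, by simp, fun a b _ _ => ⟨0, 0, fun t _ _ => by simp [RelIso.one_apply]⟩⟩

theorem IsThompson.inv {f : unitInterval ≃o unitInterval} (hf : IsThompson f) :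
    IsThompson f⁻¹ := by
  classical
  have hd := hf.isDyadic
  obtain ⟨B, hB, h⟩ := hf
  refine ⟨B.image f, ?_, ?_⟩
  · simp only [Finset.mem_image]
    rintro _ ⟨b, hb, rfl⟩
    exact hd b (hB b hb)
  · intro a b hab hc
    obtain ⟨k, r, hk⟩ := h (f.symm a) (f.symm b) (f.symm.monotone hab) (by
      intro c hcB hcab
      refine hc (f c) (Finset.mem_image_of_mem f hcB) ⟨?_, ?_⟩
      · exact f.symm_apply_lt.1 hcab.1
      · exact f.lt_symm_apply.1 hcab.2)
    refine ⟨-k, -(2 ^ (-k) * r), fun t hat htb => ?_⟩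
    have h1 := hk (f.symm t) (f.symm.monotone hat) (f.symm.monotone htb)
    rw [f.apply_symm_apply] at h1
    change ((f.symm t : unitInterval) : ℝ) = _
    rw [h1, zpow_neg]
    field_simp
    ring

theorem IsThompson.mul {f g : unitInterval ≃o unitInterval} (hf : IsThompson f)
    (hg : IsThompson g) : IsThompson (f * g) := by
  classical
  have hd : ∀ t : unitInterval, IsDyadic t → IsDyadic (g.symm t) := hg.inv.isDyadic
  obtain ⟨B, hB, h⟩ := hf
  obtain ⟨C, hC, h'⟩ := hg
  refine ⟨C ∪ B.image g.symm, ?_, ?_⟩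
  · simp only [Finset.mem_image, Finset.mem_union]
    rintro _ (hb | ⟨b, hb, rfl⟩)
    · exact hC _ hb
    · exact hd b (hB b hb)
  · intro a b hab hc
    obtain ⟨k, r, hk⟩ := h' a b hab fun c hcC => hc c (Finset.mem_union_left _ hcC)
    obtain ⟨l, q, hl⟩ := h (g a) (g b) (g.monotone hab) (by
      intro c hcB hcab
      refine hc (g.symm c) (Finset.mem_union_right _ (Finset.mem_image_of_mem _ hcB)) ⟨?_, ?_⟩
      · exact g.lt_symm_apply.2 hcab.1
      · exact g.symm_apply_lt.2 hcab.2)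
    refine ⟨l + k, 2 ^ l * r + q, fun t hat htb => ?_⟩
    have h1 := hl (g t) (g.monotone hat) (g.monotone htb)
    rw [hk t hat htb] at h1
    rw [RelIso.mul_apply, h1, zpow_add₀ (by norm_num)]
    ring

/-- Thompson's group `F`. -/
def thompsonF : Subgroup (unitInterval ≃o unitInterval) where
  carrier := {f | IsThompson f}
  mul_mem' := IsThompson.mul
  one_mem' := IsThompson.one
  inv_mem' := IsThompson.inv

/-- The piecewise formula of the generator `x₀`. -/
noncomputable def x0Fun (t : ℝ) : ℝ :=
  if t ≤ 1 / 2 then t / 2 else if t ≤ 3 / 4 then t - 1 / 4 else 2 * t - 1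

/-- The piecewise formula of the generator `x₁`. -/
noncomputable def x1Fun (t : ℝ) : ℝ :=
  if t ≤ 1 / 2 then t else if t ≤ 3 / 4 then t / 2 + 1 / 4
  else if t ≤ 7 / 8 then t - 1 / 8 else 2 * t - 1

theorem exists_orderIso (f g : ℝ → ℝ) (hf : StrictMono f) (h0 : f 0 = 0) (h1 : f 1 = 1)
    (hfg : ∀ t, f (g t) = t) :
    ∃ e : unitInterval ≃o unitInterval, ∀ t : unitInterval, (e t : ℝ) = f t := by
  have hI : ∀ t, t ∈ unitInterval ↔ f t ∈ unitInterval := by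
    intro t
    constructor
    · rintro ⟨ht0, ht1⟩
      exact ⟨h0 ▸ hf.monotone ht0, h1 ▸ hf.monotone ht1⟩
    · rintro ⟨ht0, ht1⟩
      exact ⟨hf.le_iff_le.1 (h0.symm ▸ ht0), hf.le_iff_le.1 (h1.symm ▸ ht1)⟩
  let φ : unitInterval → unitInterval := fun t => ⟨f t, (hI t).1 t.2⟩
  have hφ : StrictMono φ := fun a b hab => hf hab
  have hs : Function.Surjective φ := fun t =>
    ⟨⟨g t, (hI _).2 (by rw [hfg]; exact t.2)⟩, Subtype.ext (hfg t)⟩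
  exact ⟨hφ.orderIsoOfSurjective φ hs, fun t => rfl⟩

theorem exists_x0 : ∃ e : unitInterval ≃o unitInterval, ∀ t : unitInterval, (e t : ℝ) = x0Fun t := by
  refine exists_orderIso x0Fun
    (fun t => if t ≤ 1 / 4 then 2 * t else if t ≤ 1 / 2 then t + 1 / 4 else (t + 1) / 2) ?_ ?_ ?_ ?_
  · intro a b hab
    simp only [x0Fun]
    split_ifs <;> linarith
  · norm_num [x0Fun]
  · norm_num [x0Fun]
  · intro t
    simp only [x0Fun]
    split_ifs <;> linarith

theorem exists_x1 : ∃ e : unitInterval ≃o unitInterval, ∀ t : unitInterval, (e t : ℝ) = x1Fun t := by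
  refine exists_orderIso x1Fun
    (fun t => if t ≤ 1 / 2 then t else if t ≤ 5 / 8 then 2 * t - 1 / 2
      else if t ≤ 3 / 4 then t + 1 / 8 else (t + 1) / 2) ?_ ?_ ?_ ?_
  · intro a b hab
    simp only [x1Fun]
    split_ifs <;> linarith
  · norm_num [x1Fun]
  · norm_num [x1Fun]
  · intro t
    simp only [x1Fun]
    split_ifs <;> linarith

/-- The homeomorphism of `[0, 1]` given by the formula of `x₀`. -/
noncomputable def x0Iso : unitInterval ≃o unitInterval := exists_x0.choose

/-- The homeomorphism of `[0, 1]` given by the formula of `x₁`. -/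
noncomputable def x1Iso : unitInterval ≃o unitInterval := exists_x1.choose

theorem x0Iso_apply (t : unitInterval) : (x0Iso t : ℝ) = x0Fun t := exists_x0.choose_spec t

theorem x1Iso_apply (t : unitInterval) : (x1Iso t : ℝ) = x1Fun t := exists_x1.choose_spec t

theorem x0Iso_mem : x0Iso ∈ thompsonF := by
  classical
  let p : unitInterval := ⟨1 / 2, by norm_num, by norm_num⟩
  let q : unitInterval := ⟨3 / 4, by norm_num, by norm_num⟩
  refine ⟨{p, q}, ?_, ?_⟩
  · intro b hb
    simp only [Finset.mem_insert, Finset.mem_singleton] at hb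
    rcases hb with rfl | rfl
    · exact ⟨1, 1, by norm_num [p]⟩
    · exact ⟨3, 2, by norm_num [q]⟩
  · intro a b hab hc
    have h1 := hc p (by simp)
    have h2 := hc q (by simp)
    simp only [← Subtype.coe_lt_coe, ← Subtype.coe_le_coe, not_and, not_lt, p, q] at h1 h2 hab
    have hsplit : (b : ℝ) ≤ 1 / 2 ∨ (1 / 2 ≤ (a : ℝ) ∧ (b : ℝ) ≤ 3 / 4) ∨ 3 / 4 ≤ (a : ℝ) := by
      by_cases ha : (a : ℝ) < 1 / 2
      · exact Or.inl (h1 ha)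
      · by_cases ha' : (a : ℝ) < 3 / 4
        · exact Or.inr (Or.inl ⟨not_lt.1 ha, h2 ha'⟩)
        · exact Or.inr (Or.inr (not_lt.1 ha'))
    rcases hsplit with h | ⟨h, h'⟩ | h
    · refine ⟨-1, 0, fun t hat htb => ?_⟩
      rw [← Subtype.coe_le_coe] at hat htb
      rw [x0Iso_apply, x0Fun]
      split_ifs <;> norm_num <;> linarith
    · refine ⟨0, -1 / 4, fun t hat htb => ?_⟩
      rw [← Subtype.coe_le_coe] at hat htb
      rw [x0Iso_apply, x0Fun]
      split_ifs <;> norm_num <;> linarith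
    · refine ⟨1, -1, fun t hat htb => ?_⟩
      rw [← Subtype.coe_le_coe] at hat htb
      rw [x0Iso_apply, x0Fun]
      split_ifs <;> norm_num <;> linarith

theorem x1Iso_mem : x1Iso ∈ thompsonF := by
  classical
  let p : unitInterval := ⟨1 / 2, by norm_num, by norm_num⟩
  let q : unitInterval := ⟨3 / 4, by norm_num, by norm_num⟩
  let r : unitInterval := ⟨7 / 8, by norm_num, by norm_num⟩
  refine ⟨{p, q, r}, ?_, ?_⟩
  · intro b hb
    simp only [Finset.mem_insert, Finset.mem_singleton] at hb
    rcases hb with rfl | rfl | rfl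
    · exact ⟨1, 1, by norm_num [p]⟩
    · exact ⟨3, 2, by norm_num [q]⟩
    · exact ⟨7, 3, by norm_num [r]⟩
  · intro a b hab hc
    have h1 := hc p (by simp)
    have h2 := hc q (by simp)
    have h3 := hc r (by simp)
    simp only [← Subtype.coe_lt_coe, ← Subtype.coe_le_coe, not_and, not_lt, p, q, r]
      at h1 h2 h3 hab
    have hsplit : (b : ℝ) ≤ 1 / 2 ∨ (1 / 2 ≤ (a : ℝ) ∧ (b : ℝ) ≤ 3 / 4) ∨
        (3 / 4 ≤ (a : ℝ) ∧ (b : ℝ) ≤ 7 / 8) ∨ 7 / 8 ≤ (a : ℝ) := by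
      by_cases ha : (a : ℝ) < 1 / 2
      · exact Or.inl (h1 ha)
      · by_cases ha' : (a : ℝ) < 3 / 4
        · exact Or.inr (Or.inl ⟨not_lt.1 ha, h2 ha'⟩)
        · by_cases ha'' : (a : ℝ) < 7 / 8
          · exact Or.inr (Or.inr (Or.inl ⟨not_lt.1 ha', h3 ha''⟩))
          · exact Or.inr (Or.inr (Or.inr (not_lt.1 ha'')))
    rcases hsplit with h | ⟨h, h'⟩ | ⟨h, h'⟩ | h
    · refine ⟨0, 0, fun t hat htb => ?_⟩
      rw [← Subtype.coe_le_coe] at hat htb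
      rw [x1Iso_apply, x1Fun]
      split_ifs <;> norm_num <;> linarith
    · refine ⟨-1, 1 / 4, fun t hat htb => ?_⟩
      rw [← Subtype.coe_le_coe] at hat htb
      rw [x1Iso_apply, x1Fun]
      split_ifs <;> norm_num <;> linarith
    · refine ⟨0, -1 / 8, fun t hat htb => ?_⟩
      rw [← Subtype.coe_le_coe] at hat htb
      rw [x1Iso_apply, x1Fun]
      split_ifs <;> norm_num <;> linarith
    · refine ⟨1, -1, fun t hat htb => ?_⟩
      rw [← Subtype.coe_le_coe] at hat htb
      rw [x1Iso_apply, x1Fun]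
      split_ifs <;> norm_num <;> linarith

/-- The standard generators `x₀`, `x₁` of `F`. -/
noncomputable def gen : Fin 2 → thompsonF := ![⟨x0Iso, x0Iso_mem⟩, ⟨x1Iso, x1Iso_mem⟩]

/-! ### Schreier graphs -/

/-- The Schreier graph of the action of a group `G` on `M` with respect to a pair `S` of generators:
there is an arrow labeled `s` from `x` to `y` if and only if the generator `S s` moves `x` to
`y`. -/
def schreierGraph {G : Type*} [Group G] (S : Fin 2 → G) (M : Type) [MulAction G M] :
    MarkedGraph where
  V := M
  adj s x y := S s • x = y
  out_unique s x := ⟨S s • x, rfl, fun _ h => h.symm⟩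
  in_unique s y := ⟨(S s)⁻¹ • y, smul_inv_smul _ _, fun _ h => by rw [← h, inv_smul_smul]⟩

/-- The point `1 / 2` of `[0, 1]`. -/
noncomputable def half : unitInterval := ⟨1 / 2, by norm_num, by norm_num⟩

/-- The Schreier graph of the action of `F` on the orbit of `1 / 2` with respect to `x₀`, `x₁`. -/
noncomputable def dyadicGraph : MarkedGraph :=
  schreierGraph gen (MulAction.orbit thompsonF half)

theorem mem_orbit_isDyadic (t : MulAction.orbit thompsonF half) :
    IsDyadic (t : unitInterval) ∧ 0 < ((t : unitInterval) : ℝ) ∧ ((t : unitInterval) : ℝ) < 1 := by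
  obtain ⟨t, ⟨f, hf⟩, rfl⟩ := t
  change IsDyadic (f half) ∧ 0 < ((f half : unitInterval) : ℝ) ∧ ((f half : unitInterval) : ℝ) < 1
  refine ⟨IsThompson.isDyadic hf half ⟨1, 1, by norm_num [half]⟩, ?_, ?_⟩
  · have h : f 0 < f half := f.strictMono (by
      rw [← Subtype.coe_lt_coe]; norm_num [half])
    exact lt_of_le_of_lt (f 0).2.1 h
  · have h : f half < f 1 := f.strictMono (by
      rw [← Subtype.coe_lt_coe]; norm_num [half])
    exact lt_of_lt_of_le h (f 1).2.2

theorem exists_link_fwd (t : MulAction.orbit thompsonF half) :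
    ∃ u : MulAction.orbit thompsonF half, dyadicGraph.Link t u ∧ ((u.1 : unitInterval) : ℝ) = x0Fun (t.1 : ℝ) :=
  ⟨gen 0 • t, ⟨0, Or.inl rfl⟩, x0Iso_apply _⟩

theorem exists_link_bwd (t : MulAction.orbit thompsonF half) :
    ∃ u : MulAction.orbit thompsonF half, dyadicGraph.Link t u ∧ x0Fun (u.1 : ℝ) = (t.1 : ℝ) := by
  refine ⟨(gen 0)⁻¹ • t, ⟨0, Or.inr ?_⟩, ?_⟩
  · exact smul_inv_smul (gen 0) t
  · rw [← x0Iso_apply]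
    exact congrArg (fun u : MulAction.orbit thompsonF half => ((u : unitInterval) : ℝ))
      (smul_inv_smul (gen 0) t)

theorem exists_link_bwd1 (t : MulAction.orbit thompsonF half) :
    ∃ u : MulAction.orbit thompsonF half, dyadicGraph.Link t u ∧ x1Fun (u.1 : ℝ) = (t.1 : ℝ) := by
  refine ⟨(gen 1)⁻¹ • t, ⟨1, Or.inr ?_⟩, ?_⟩
  · exact smul_inv_smul (gen 1) t
  · rw [← x1Iso_apply]
    exact congrArg (fun u : MulAction.orbit thompsonF half => ((u : unitInterval) : ℝ))
      (smul_inv_smul (gen 1) t)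

theorem reach_half (h0 : dyadicGraph.V) (hh0 : ((h0.1 : unitInterval) : ℝ) = 1 / 2) (m : ℕ) :
    ∀ (t : dyadicGraph.V) (k : ℤ), 2 ^ m * ((t.1 : unitInterval) : ℝ) = k →
      Relation.ReflTransGen dyadicGraph.Link t h0 := by
  induction m with
  | zero =>
    intro t k hk
    obtain ⟨_, h1, h2⟩ := mem_orbit_isDyadic t
    simp only [pow_zero, one_mul] at hk
    rw [hk] at h1 h2
    have h1' : 0 < k := by exact_mod_cast h1
    have h2' : k < 1 := by exact_mod_cast h2
    omega
  | succ m ih =>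
    have heq : ∀ t : dyadicGraph.V, ((t.1 : unitInterval) : ℝ) = 1 / 2 → t = h0 := fun t ht =>
      Subtype.ext (Subtype.ext (ht.trans hh0.symm))
    have grey : ∀ (t : dyadicGraph.V) (k : ℤ), 2 ^ (m + 1) * ((t.1 : unitInterval) : ℝ) = k →
        1 / 2 ≤ ((t.1 : unitInterval) : ℝ) → ((t.1 : unitInterval) : ℝ) ≤ 3 / 4 →
        Relation.ReflTransGen dyadicGraph.Link t h0 := by
      intro t k hk h1 h2
      rcases eq_or_lt_of_le h1 with h1 | h1
      · rw [heq t h1.symm]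
      rcases eq_or_lt_of_le h2 with h2 | h2
      · obtain ⟨u, hu, hu'⟩ := exists_link_fwd t
        rw [← heq u (by rw [hu', h2]; norm_num [x0Fun])]
        exact Relation.ReflTransGen.single hu
      obtain ⟨u, hu, hu'⟩ := exists_link_bwd1 t
      by_cases h3 : ((t.1 : unitInterval) : ℝ) ≤ 5 / 8
      · have hv : ((u.1 : unitInterval) : ℝ) = 2 * ((t.1 : unitInterval) : ℝ) - 1 / 2 := by
          unfold x1Fun at hu'
          split_ifs at hu' <;> linarith
        obtain _ | m := m
        · exfalso
          norm_num at hk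
          have h4 : (1 : ℝ) < k := by linarith
          have h5 : (k : ℝ) < 2 := by linarith
          have h4' : 1 < k := by exact_mod_cast h4
          have h5' : k < 2 := by exact_mod_cast h5
          omega
        · refine Relation.ReflTransGen.head hu (ih u (k - 2 ^ m) ?_)
          rw [hv]; push_cast; rw [← hk]; ring
      · push Not at h3
        have hv : ((u.1 : unitInterval) : ℝ) = ((t.1 : unitInterval) : ℝ) + 1 / 8 := by
          unfold x1Fun at hu'
          split_ifs at hu' <;> linarith
        obtain ⟨v, hv1, hv2⟩ := exists_link_fwd u
        have hv3 : ((v.1 : unitInterval) : ℝ) = 2 * ((t.1 : unitInterval) : ℝ) - 3 / 4 := by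
          rw [hv2, hv]
          unfold x0Fun
          split_ifs <;> linarith
        obtain _ | _ | m := m
        · exfalso
          norm_num at hk
          have h4 : (1 : ℝ) < k := by linarith
          have h5 : (k : ℝ) < 2 := by linarith
          have h4' : 1 < k := by exact_mod_cast h4
          have h5' : k < 2 := by exact_mod_cast h5
          omega
        · exfalso
          norm_num at hk
          have h4 : (2 : ℝ) < k := by linarith
          have h5 : (k : ℝ) < 3 := by linarith
          have h4' : 2 < k := by exact_mod_cast h4
          have h5' : k < 3 := by exact_mod_cast h5
          omega
        · refine Relation.ReflTransGen.head hu (Relation.ReflTransGen.head hv1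
            (ih v (k - 3 * 2 ^ m) ?_))
          rw [hv3]; push_cast; rw [← hk]; ring
    intro t k hk
    obtain ⟨_, h1, h2⟩ := mem_orbit_isDyadic t
    rcases le_or_gt (3 / 4) ((t.1 : unitInterval) : ℝ) with h3 | h3
    · obtain ⟨u, hu, hu'⟩ := exists_link_fwd t
      refine Relation.ReflTransGen.head hu (ih u (k - 2 ^ m) ?_)
      have hv : ((u.1 : unitInterval) : ℝ) = 2 * ((t.1 : unitInterval) : ℝ) - 1 := by
        rw [hu']
        unfold x0Fun
        split_ifs <;> linarith
      rw [hv]; push_cast; rw [← hk]; ring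
    rcases le_or_gt (1 / 2) ((t.1 : unitInterval) : ℝ) with h4 | h4
    · exact grey t k hk h4 h3.le
    obtain ⟨u, hu, hu'⟩ := exists_link_bwd t
    rcases le_or_gt ((t.1 : unitInterval) : ℝ) (1 / 4) with h5 | h5
    · refine Relation.ReflTransGen.head hu (ih u k ?_)
      have hv : ((u.1 : unitInterval) : ℝ) = 2 * ((t.1 : unitInterval) : ℝ) := by
        unfold x0Fun at hu'
        split_ifs at hu' <;> linarith
      rw [hv, ← hk]; ring
    · have hv : ((u.1 : unitInterval) : ℝ) = ((t.1 : unitInterval) : ℝ) + 1 / 4 := by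
        unfold x0Fun at hu'
        split_ifs at hu' <;> linarith
      obtain _ | m := m
      · exfalso
        norm_num at hk
        have h4 : (0 : ℝ) < k := by linarith
        have h5 : (k : ℝ) < 1 := by linarith
        have h4' : 0 < k := by exact_mod_cast h4
        have h5' : k < 1 := by exact_mod_cast h5
        omega
      · refine Relation.ReflTransGen.head hu (grey u (k + 2 ^ m) ?_ (by linarith) (by linarith))
        rw [hv]; push_cast; rw [← hk]; ring

theorem MarkedGraph.link_symm {G : MarkedGraph} {x y : G.V}
    (h : Relation.ReflTransGen G.Link x y) : Relation.ReflTransGen G.Link y x := by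
  induction h with
  | refl => exact Relation.ReflTransGen.refl
  | tail _ hl ih =>
    obtain ⟨s, hs⟩ := hl
    exact Relation.ReflTransGen.head ⟨s, hs.symm⟩ ih

theorem MarkedGraph.connected_of_reach {G : MarkedGraph} (b : G.V)
    (h : ∀ x, Relation.ReflTransGen G.Link x b) : G.Connected := by
  intro x y
  exact (h x).trans (link_symm (h y))

theorem dyadicGraph_connected : dyadicGraph.Connected := by
  let h0 : dyadicGraph.V := ⟨half, MulAction.mem_orbit_self half⟩
  refine MarkedGraph.connected_of_reach h0 fun t => ?_
  obtain ⟨⟨k, m, hk⟩, -⟩ := mem_orbit_isDyadic t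
  exact reach_half h0 rfl m t k (by
    have hk' : ((t.1 : unitInterval) : ℝ) = k / 2 ^ m := hk
    rw [hk']; field_simp)

/-- Graphs of type A: the pointed Schreier graphs of the dyadic rational numbers in `(0, 1)`, that
is, the Schreier graph of the orbit of `1 / 2` with any of its vertices as the base. -/
noncomputable def typeA : Set GraphSpace :=
  {g | ∃ q : dyadicGraph.V, g = GraphSpace.mk ⟨dyadicGraph, dyadicGraph_connected, q⟩}

/-! ### Graphs of type B -/

/-- The marked graph whose arrows labeled `s` lead from `x` to `σ s x`. -/
def ofPerm {V : Type} (σ : Fin 2 → Equiv.Perm V) : MarkedGraph where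
  V := V
  adj s x y := σ s x = y
  out_unique s x := ⟨σ s x, rfl, fun _ h => h.symm⟩
  in_unique s y := ⟨(σ s).symm y, by simp, fun _ h => by simp [← h]⟩

/-- The grey vertices of the graph of type B with upward path `w`: the binary tree without root in
which an infinite path going up from a vertex of level `0` turns according to the letters of `w`.
A vertex is given by its level `ℓ` and by the sequence `v` of the turns of the infinite path
going up from it, the `j`-th turn leading from level `ℓ + j` to level `ℓ + j + 1`; the paths from
any two vertices merge, so that `v` agrees with `w` from some level on. The label of the vertex is
`10v`. -/
def Tree (w : ℕ → Bool) : Type :=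
  {p : ℤ × (ℕ → Bool) // ∃ N : ℕ, ∀ i j : ℕ, N ≤ i → (i : ℤ) = p.1 + j → p.2 j = w i}

namespace Tree

variable {w : ℕ → Bool}

/-- The vertex right above a vertex. -/
def parent (τ : Tree w) : Tree w :=
  ⟨(τ.1.1 + 1, fun j => τ.1.2 (j + 1)), by
    obtain ⟨N, hN⟩ := τ.2
    exact ⟨N, fun i j hi hij => hN i (j + 1) hi (by push_cast; simp only at hij; omega)⟩⟩

/-- The two vertices right below a vertex. -/
def child (b : Bool) (τ : Tree w) : Tree w :=
  ⟨(τ.1.1 - 1, fun j => Nat.casesOn j b τ.1.2), by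
    obtain ⟨N, hN⟩ := τ.2
    refine ⟨max N τ.1.1.toNat, fun i j hi hij => ?_⟩
    simp only at hij
    have h1 : N ≤ i := le_of_max_le_left hi
    have h2 : τ.1.1.toNat ≤ i := le_of_max_le_right hi
    cases j with
    | zero => exfalso; push_cast at hij; omega
    | succ j => exact hN i j h1 (by push_cast at hij; omega)⟩

theorem parent_child (b : Bool) (τ : Tree w) : (child b τ).parent = τ := by
  apply Subtype.ext
  simp [parent, child]

theorem child_parent (b : Bool) (τ : Tree w) (h : τ.1.2 0 = b) : child b τ.parent = τ := by
  apply Subtype.ext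
  refine Prod.ext (by simp [parent, child]) ?_
  funext j
  cases j with
  | zero => exact h.symm
  | succ j => rfl

end Tree

/-- The arrows labeled `x₀` of a graph of type B. The vertices are the pairs `(τ, n)` of a grey
vertex `τ`, with label `10v`, and an integer `n`: `(τ, 0)` is `τ` itself, `(τ, n)` for `n > 0` is the
black vertex with label `0ⁿ1v`, and `(τ, -n)` for `n > 0` is the white vertex with label
`1ⁿ⁺¹0v`. -/
def treeX0 (w : ℕ → Bool) : Equiv.Perm (Tree w × ℤ) where
  toFun p := (p.1, p.2 + 1)
  invFun p := (p.1, p.2 - 1)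
  left_inv p := by simp
  right_inv p := by simp

/-- The arrows labeled `x₁` of a graph of type B: there are loops at the black vertices, `10v` leads
to the grey vertex `100v` below it, `110v` leads to the grey vertex `101v`, and `111u` leads to
`11u`. -/
def treeX1 (w : ℕ → Bool) : Equiv.Perm (Tree w × ℤ) where
  toFun p := if 0 < p.2 then p else if p.2 = 0 then (p.1.child false, 0)
    else if p.2 = -1 then (p.1.child true, 0) else (p.1, p.2 + 1)
  invFun p := if 0 < p.2 then p else if p.2 = 0 then
      (if p.1.1.2 0 then (p.1.parent, -1) else (p.1.parent, 0))
    else (p.1, p.2 - 1)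
  left_inv := by
    rintro ⟨τ, n⟩
    rcases lt_trichotomy n 0 with h | h | h
    · by_cases h1 : n = -1
      · subst h1
        simp [Tree.parent_child]
        rfl
      · have h2 : ¬ 0 < n := by omega
        have h3 : ¬ n = 0 := by omega
        have h4 : ¬ 0 < n + 1 := by omega
        have h5 : ¬ n + 1 = 0 := by omega
        simp [h1, h2, h3, h4, h5]
    · subst h
      simp [Tree.parent_child]
      rfl
    · simp [h]
  right_inv := by
    rintro ⟨τ, n⟩
    rcases lt_trichotomy n 0 with h | h | h
    · have h2 : ¬ 0 < n := by omega
      have h3 : ¬ n = 0 := by omega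
      have h4 : ¬ 0 < n - 1 := by omega
      have h5 : ¬ n - 1 = 0 := by omega
      have h6 : ¬ n - 1 = -1 := by omega
      simp only [h2, h3, if_false, h4, h5, h6, sub_add_cancel]
    · subst h
      by_cases hb : τ.1.2 0 = true
      · simp [hb, Tree.child_parent true τ hb]
      · have hb' : τ.1.2 0 = false := by simpa using hb
        simp [hb', Tree.child_parent false τ hb']
    · simp [h]

/-- The graph of type B in which an infinite path going up turns left or right according to the
letters of `w`. -/
def treeGraph (w : ℕ → Bool) : MarkedGraph := ofPerm ![treeX0 w, treeX1 w]

theorem treeGraph_reach_zero (w : ℕ → Bool) (τ : Tree w) (n : ℤ) :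
    Relation.ReflTransGen (treeGraph w).Link ((τ, n) : Tree w × ℤ) ((τ, 0) : Tree w × ℤ) := by
  induction n using Int.induction_on with
  | zero => exact Relation.ReflTransGen.refl
  | succ n ih =>
    refine Relation.ReflTransGen.head ⟨0, Or.inr ?_⟩ ih
    rfl
  | pred n ih =>
    refine Relation.ReflTransGen.head ⟨0, Or.inl ?_⟩ ih
    exact (treeX0 w).apply_symm_apply ((τ, -n) : Tree w × ℤ)

theorem treeGraph_reach_parent (w : ℕ → Bool) (τ : Tree w) :
    Relation.ReflTransGen (treeGraph w).Link ((τ, 0) : Tree w × ℤ)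
      ((τ.parent, 0) : Tree w × ℤ) := by
  have h : Relation.ReflTransGen (treeGraph w).Link ((τ, 0) : Tree w × ℤ)
      ((treeX1 w).symm (τ, 0)) :=
    Relation.ReflTransGen.single ⟨1, Or.inr ((treeX1 w).apply_symm_apply _)⟩
  refine h.trans ?_
  have h2 : (treeX1 w).symm (τ, 0) = (τ.parent, ((treeX1 w).symm (τ, 0)).2) := by
    refine Prod.ext ?_ rfl
    change (if (0 : ℤ) < 0 then (τ, (0 : ℤ)) else if (0 : ℤ) = 0 then
      (if τ.1.2 0 then (τ.parent, -1) else (τ.parent, 0)) else (τ, 0 - 1)).1 = τ.parent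
    split_ifs <;> first | rfl | omega
  rw [h2]
  exact treeGraph_reach_zero w _ _

/-- The grey vertex of level `N` on the path `w`. -/
def spine (w : ℕ → Bool) (N : ℕ) : Tree w :=
  ⟨(N, fun j => w (N + j)), 0, fun i j _ hij => by
    have : i = N + j := by simp only at hij; exact_mod_cast hij
    rw [this]⟩

theorem treeGraph_reach_spine (w : ℕ → Bool) (k : ℕ) : ∀ τ : Tree w, ∀ N : ℕ,
    τ.1.1 + k = N → (∀ i j : ℕ, N ≤ i → (i : ℤ) = τ.1.1 + j → τ.1.2 j = w i) →
    Relation.ReflTransGen (treeGraph w).Link ((τ, 0) : Tree w × ℤ)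
      ((spine w N, 0) : Tree w × ℤ) := by
  induction k with
  | zero =>
    intro τ N h hN
    have : τ = spine w N := by
      apply Subtype.ext
      refine Prod.ext (by simpa [spine] using h) ?_
      funext j
      exact hN (N + j) j (by omega) (by push_cast; simp at h; omega)
    rw [this]
    exact Relation.ReflTransGen.refl
  | succ k ih =>
    intro τ N h hN
    refine (treeGraph_reach_parent w τ).trans (ih τ.parent N ?_ ?_)
    · simp only [Tree.parent]; push_cast at h; omega
    · intro i j hi hij
      exact hN i (j + 1) hi (by simp only [Tree.parent] at hij; push_cast; omega)

theorem treeGraph_connected (w : ℕ → Bool) : (treeGraph w).Connected := by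
  refine MarkedGraph.connected_of_reach (G := treeGraph w) ((spine w 0, 0) : Tree w × ℤ) ?_
  rintro ⟨τ, n⟩
  refine (treeGraph_reach_zero w τ n).trans ?_
  obtain ⟨N, hN⟩ := τ.2
  have h1 := treeGraph_reach_spine w (max (N : ℤ) τ.1.1 - τ.1.1).toNat τ (max (N : ℤ) τ.1.1).toNat
    (by omega) (fun i j hi hij => hN i j (by omega) hij)
  have h2 := treeGraph_reach_spine w (max (N : ℤ) τ.1.1).toNat (spine w 0)
    (max (N : ℤ) τ.1.1).toNat (by simp [spine]) (fun i j hi hij => by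
      have : i = j := by simp [spine] at hij; omega
      simp [spine, this])
  refine h1.trans ?_
  exact MarkedGraph.link_symm h2

/-- Graphs of type B, with any vertex as the base. -/
def typeB : Set GraphSpace :=
  {g | ∃ (w : ℕ → Bool) (x : (treeGraph w).V),
    g = GraphSpace.mk ⟨treeGraph w, treeGraph_connected w, x⟩}

/-! ### Graphs of type C -/

/-- The line with vertices the integers, with arrows labeled `x₀` from `n` to `n + 1` and arrows
labeled `x₁` from `n` to `n + d`: for `d = 0` the `x₁`-arrows are loops, as at the black vertices,
and for `d = 1` they are parallel to the `x₀`-arrows, as at the white vertices. -/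
def lineGraph (d : ℤ) : MarkedGraph := ofPerm ![Equiv.addRight 1, Equiv.addRight d]

theorem lineGraph_connected (d : ℤ) : (lineGraph d).Connected := by
  refine MarkedGraph.connected_of_reach (G := lineGraph d) (0 : ℤ) fun n => ?_
  change ℤ at n
  induction n using Int.induction_on with
  | zero => exact Relation.ReflTransGen.refl
  | succ n ih =>
    refine Relation.ReflTransGen.head ⟨0, Or.inr ?_⟩ ih
    rfl
  | pred n ih =>
    refine Relation.ReflTransGen.head ⟨0, Or.inl ?_⟩ ih
    exact sub_add_cancel (-(n : ℤ)) 1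

/-- The two graphs of type C (all choices of the base vertex are isomorphic). -/
def typeC : Set GraphSpace :=
  {GraphSpace.mk ⟨lineGraph 0, lineGraph_connected 0, (0 : ℤ)⟩,
    GraphSpace.mk ⟨lineGraph 1, lineGraph_connected 1, (0 : ℤ)⟩}

/-! ### Cantor–Bendixson rank -/

/-- The Cantor–Bendixson rank: the least ordinal number of times one has to remove the isolated
points of `s` to get a set without isolated points. -/
noncomputable def cantorBendixsonRank {X : Type*} [TopologicalSpace X] (s : Set X) : Ordinal :=
  sInf {a | Preperfect (CantorBendixson.iteratedDerivedSet s a)}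

end SchreierF

namespace SchreierF

/-! ### Isomorphisms of balls from relations between vertices -/

namespace PointedGraph

/-! The graphs of types A and B have vertex set `T × ℤ`, where a bijection `e : T ≃ Bool × T` splits
an element of `T` into its first letter and its parent. The `x₀`-arrows form the lines `{τ} × ℤ`,
and the `x₁`-arrows leave a line only from the coordinates `0` and `-1`, towards the two children of
`τ`. For type B, `T` is the rootless tree. For the orbit of `1/2`, `T` consists of the binary words
with finitely many letters `1`, a dyadic number being labeled by its binary expansion. One thing
distinguishes the two: the word `000…` is its own child, which puts an `x₁`-loop at the grey vertex
`1/2`, while in the rootless tree the level forbids this.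

A ball in a graph of type B depends only on the position `n` of the base on its line and on finitely
many letters of the upward word `v` (`treePt_ballIso`); if `n` is far from `0`, it is a ball of one
of the two graphs of type C. Let the sequence `b0ᵏ1v` encode `(v, n)`, where `b` is the sign of `n`
and `k` grows with `|n|`, and let `b000…` encode the graphs of type C. Then `decode` is continuous
on the Cantor space, with image the graphs of types B and C. It is injective because `n` can be read
from the loops and `v` from the path going up (`treePt_injective`). Hence this image is compact,
perfect and a Cantor set.

For each `r`, all but finitely many vertices `(v, n)` of the Schreier graph have the same ball of
radius `r` as the graph of type B with the same `v` and `n` (`finite_not_ballIso`): it suffices that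
`v` has a letter `1` beyond position `r`, or that `|n|` is large. Therefore the accumulation points
of type A are exactly the image of `decode` (`derivedSet_typeA`). No graph of type A lies there,
because of the loop at `1/2`, so one derivation of the closure removes exactly type A and leaves a
perfect set. -/

theorem exists_rel_of_mem_ball {Γ Δ : PointedGraph} {R : ℕ → Γ.V → Δ.V → Prop}
    (mono : ∀ k x y, R (k + 1) x y → R k x y)
    (fwd : ∀ k s x y x' y', R (k + 1) x y → Γ.adj s x x' → Δ.adj s y y' → R k x' y')
    (bwd : ∀ k s x y x' y', R (k + 1) x y → Γ.adj s x' x → Δ.adj s y' y → R k x' y')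
    {n : ℕ} (base : R n Γ.base Δ.base) (k : ℕ) :
    ∀ m, m + k = n → ∀ x ∈ Γ.ball k, ∃ y ∈ Δ.ball k, R m x y := by
  induction k with
  | zero =>
    rintro m hm x hx
    obtain rfl : x = Γ.base := hx
    obtain rfl : m = n := hm
    exact ⟨Δ.base, rfl, base⟩
  | succ k ih =>
    rintro m hm x (hx | ⟨x₀, hx₀, s, h | h⟩)
    · obtain ⟨y, hy, hxy⟩ := ih (m + 1) (by omega) x hx
      exact ⟨y, Or.inl hy, mono _ _ _ hxy⟩
    · obtain ⟨y, hy, hxy⟩ := ih (m + 1) (by omega) x₀ hx₀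
      obtain ⟨y', hy', -⟩ := Δ.out_unique s y
      exact ⟨y', Or.inr ⟨y, hy, s, Or.inl hy'⟩, fwd _ _ _ _ _ _ hxy h hy'⟩
    · obtain ⟨y, hy, hxy⟩ := ih (m + 1) (by omega) x₀ hx₀
      obtain ⟨y', hy', -⟩ := Δ.in_unique s y
      exact ⟨y', Or.inr ⟨y, hy, s, Or.inr hy'⟩, bwd _ _ _ _ _ _ hxy h hy'⟩

/-- A sequence of relations between the vertices of two graphs, such that each of them passes to
the previous one along every arrow, and the first one is a partial bijection, gives an isomorphism
of balls. -/
theorem ballIso_of_rel {Γ Δ : PointedGraph} {R : ℕ → Γ.V → Δ.V → Prop}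
    (mono : ∀ k x y, R (k + 1) x y → R k x y)
    (fwd : ∀ k s x y x' y', R (k + 1) x y → Γ.adj s x x' → Δ.adj s y y' → R k x' y')
    (bwd : ∀ k s x y x' y', R (k + 1) x y → Γ.adj s x' x → Δ.adj s y' y → R k x' y')
    (uniq : ∀ x y x' y', R 0 x y → R 0 x' y' → (x = x' ↔ y = y'))
    {n : ℕ} (base : R (n + 1) Γ.base Δ.base) : BallIso n Γ Δ := by
  -- Starting with index `n + 1` leaves index `1` on the whole ball of radius `n`. The spare unit
  -- allows one more arrow, landing in `R 0`, which is needed to compare arrows inside the ball.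
  have h := exists_rel_of_mem_ball mono fwd bwd base n 1 (by omega)
  have h' := exists_rel_of_mem_ball (Γ := Δ) (Δ := Γ) (R := fun k y x => R k x y)
    (fun k y x => mono k x y) (fun k s y x y' x' hr h₁ h₂ => fwd k s x y x' y' hr h₂ h₁)
    (fun k s y x y' x' hr h₁ h₂ => bwd k s x y x' y' hr h₂ h₁) base n 1 (by omega)
  choose f hf hR using h
  have huniq : ∀ x y x' y', R 1 x y → R 1 x' y' → (x = x' ↔ y = y') := fun x y x' y' h₁ h₂ =>
    uniq x y x' y' (mono 0 x y h₁) (mono 0 x' y' h₂)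
  let φ : Γ.ball n → Δ.ball n := fun x => ⟨f x.1 x.2, hf x.1 x.2⟩
  have hφ : Function.Bijective φ := by
    constructor
    · intro x x' hxx
      exact Subtype.ext ((huniq _ _ _ _ (hR _ x.2) (hR _ x'.2)).2 (congrArg Subtype.val hxx))
    · intro y
      obtain ⟨x, hx, hxy⟩ := h' y.1 y.2
      exact ⟨⟨x, hx⟩, Subtype.ext ((huniq _ _ _ _ (hR x hx) hxy).1 rfl)⟩
  have hb : R 1 Γ.base Δ.base := by
    have : ∀ m, R (m + 1) Γ.base Δ.base → R 1 Γ.base Δ.base := fun m => by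
      induction m with
      | zero => exact id
      | succ m ih => exact fun h => ih (mono _ _ _ h)
    exact this n base
  refine ⟨Equiv.ofBijective φ hφ, fun x hx => ?_, fun s x y => ?_⟩
  · exact (huniq _ _ _ _ (hR _ x.2) hb).1 hx
  · change Γ.adj s x.1 y.1 ↔ Δ.adj s (f x.1 x.2) (f y.1 y.2)
    constructor
    · intro h
      -- The target `z` of the corresponding arrow is `R 0`-related to `y`, as is `f y`, so the two
      -- coincide.
      obtain ⟨z, hz, -⟩ := Δ.out_unique s (f x.1 x.2)
      have h₁ := fwd _ _ _ _ _ _ (hR _ x.2) h hz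
      rwa [(uniq _ _ _ _ (mono _ _ _ (hR _ y.2)) h₁).1 rfl]
    · intro h
      obtain ⟨z, hz, -⟩ := Γ.out_unique s x.1
      have h₁ := fwd _ _ _ _ _ _ (hR _ x.2) hz h
      rwa [(uniq _ _ _ _ (mono _ _ _ (hR _ y.2)) h₁).2 rfl]

end PointedGraph

/-! ### The graph of a binary splitting -/

section Splitting

variable {T : Type} (e : T ≃ Bool × T)

/-- The `x₁`-arrows on `T × ℤ`, where the bijection `e` sends an element of `T` to its first letter
and its parent. -/
def splitX1 : Equiv.Perm (T × ℤ) where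
  toFun p := if 0 < p.2 then p else if p.2 = 0 then (e.symm (false, p.1), 0)
    else if p.2 = -1 then (e.symm (true, p.1), 0) else (p.1, p.2 + 1)
  invFun p := if 0 < p.2 then p else if p.2 = 0 then
      (if (e p.1).1 then ((e p.1).2, -1) else ((e p.1).2, 0))
    else (p.1, p.2 - 1)
  left_inv := by
    rintro ⟨τ, n⟩
    rcases lt_trichotomy n 0 with h | h | h
    · by_cases h1 : n = -1
      · subst h1
        simp
      · have h2 : ¬ 0 < n := by omega
        have h3 : ¬ n = 0 := by omega
        have h4 : ¬ 0 < n + 1 := by omega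
        have h5 : ¬ n + 1 = 0 := by omega
        simp [h1, h2, h3, h4, h5]
    · subst h
      simp
    · simp [h]
  right_inv := by
    rintro ⟨τ, n⟩
    rcases lt_trichotomy n 0 with h | h | h
    · have h2 : ¬ 0 < n := by omega
      have h3 : ¬ n = 0 := by omega
      have h4 : ¬ 0 < n - 1 := by omega
      have h5 : ¬ n - 1 = 0 := by omega
      have h6 : ¬ n - 1 = -1 := by omega
      simp only [h2, h3, if_false, h4, h5, h6, sub_add_cancel]
    · subst h
      by_cases hb : (e τ).1 = true
      · have h1 : e.symm (true, (e τ).2) = τ := by rw [← hb]; simp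
        simp [hb, h1]
      · have hb' : (e τ).1 = false := by simpa using hb
        have h1 : e.symm (false, (e τ).2) = τ := by rw [← hb']; simp
        simp [hb', h1]
    · simp [h]

/-- The `x₀`-arrows on `T × ℤ`. -/
def splitX0 (T : Type) : Equiv.Perm (T × ℤ) where
  toFun p := (p.1, p.2 + 1)
  invFun p := (p.1, p.2 - 1)
  left_inv p := by simp
  right_inv p := by simp

/-- The marked graph with vertex set `T × ℤ` defined by a splitting of `T`. -/
def splitGraph : MarkedGraph := ofPerm ![splitX0 T, splitX1 e]

theorem splitX1_of_pos {τ : T} {n : ℤ} (h : 0 < n) : splitX1 e (τ, n) = (τ, n) := if_pos h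

theorem splitX1_zero (τ : T) : splitX1 e (τ, 0) = (e.symm (false, τ), 0) := rfl

theorem splitX1_neg_one (τ : T) : splitX1 e (τ, -1) = (e.symm (true, τ), 0) := rfl

theorem splitX1_of_lt {τ : T} {n : ℤ} (h : n < -1) : splitX1 e (τ, n) = (τ, n + 1) := by
  have h1 : ¬ 0 < n := by omega
  have h2 : ¬ n = 0 := by omega
  have h3 : ¬ n = -1 := by omega
  simp [splitX1, h1, h2, h3]

theorem splitX1_symm_of_pos {τ : T} {n : ℤ} (h : 0 < n) :
    (splitX1 e).symm (τ, n) = (τ, n) := if_pos h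

theorem splitX1_symm_zero (τ : T) :
    (splitX1 e).symm (τ, 0) = ((e τ).2, if (e τ).1 then -1 else 0) := by
  change (if (e τ).1 then ((e τ).2, (-1 : ℤ)) else ((e τ).2, 0)) = _
  split_ifs <;> rfl

theorem splitX1_symm_of_neg {τ : T} {n : ℤ} (h : n < 0) :
    (splitX1 e).symm (τ, n) = (τ, n - 1) := by
  have h1 : ¬ 0 < n := by omega
  have h2 : ¬ n = 0 := by omega
  simp [splitX1, h1, h2]

/-- The graph of a splitting, pointed at a vertex. -/
def splitPt (h : (splitGraph e).Connected) (τ : T) (n : ℤ) : PointedGraph :=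
  ⟨splitGraph e, h, ((τ, n) : T × ℤ)⟩

variable {T' : Type} (e' : T' ≃ Bool × T')

/-- The arrows move the integer coordinate by a rule that involves `T` only through the first
letter, and they move in `T` only to a child or to the parent. So relations on `T` that survive
these moves suffice, with the integer coordinates kept equal. -/
theorem splitPt_ballIso (h : (splitGraph e).Connected) (h' : (splitGraph e').Connected)
    {P : ℕ → T → T' → Prop} (mono : ∀ k τ υ, P (k + 1) τ υ → P k τ υ)
    (child : ∀ k b τ υ, P (k + 1) τ υ → P k (e.symm (b, τ)) (e'.symm (b, υ)))
    (parent : ∀ k τ υ, P (k + 1) τ υ → (e τ).1 = (e' υ).1 ∧ P k (e τ).2 (e' υ).2)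
    (uniq : ∀ τ υ τ' υ', P 0 τ υ → P 0 τ' υ' → (τ = τ' ↔ υ = υ'))
    {n : ℕ} {τ : T} {υ : T'} (hP : P (n + 1) τ υ) (m : ℤ) :
    PointedGraph.BallIso n (splitPt e h τ m) (splitPt e' h' υ m) := by
  refine PointedGraph.ballIso_of_rel (Γ := splitPt e h τ m) (Δ := splitPt e' h' υ m)
    (R := fun k (x : T × ℤ) (y : T' × ℤ) => x.2 = y.2 ∧ P k x.1 y.1) ?_ ?_ ?_ ?_ ⟨rfl, hP⟩
  · exact fun k x y hxy => ⟨hxy.1, mono _ _ _ hxy.2⟩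
  · rintro k s ⟨τ, n⟩ ⟨υ, n'⟩ x' y' ⟨hn, hP⟩ hx hy
    obtain rfl : n = n' := hn
    replace hP : P (k + 1) τ υ := hP
    fin_cases s
    · obtain rfl : (τ, n + 1) = x' := hx
      obtain rfl : (υ, n + 1) = y' := hy
      exact ⟨rfl, mono _ _ _ hP⟩
    · obtain rfl : splitX1 e (τ, n) = x' := hx
      obtain rfl : splitX1 e' (υ, n) = y' := hy
      rcases lt_trichotomy n 0 with hn | rfl | hn
      · rcases eq_or_ne n (-1) with rfl | h1
        · rw [splitX1_neg_one, splitX1_neg_one]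
          exact ⟨rfl, child _ _ _ _ hP⟩
        · rw [splitX1_of_lt e (by omega), splitX1_of_lt e' (by omega)]
          exact ⟨rfl, mono _ _ _ hP⟩
      · rw [splitX1_zero, splitX1_zero]
        exact ⟨rfl, child _ _ _ _ hP⟩
      · rw [splitX1_of_pos e hn, splitX1_of_pos e' hn]
        exact ⟨rfl, mono _ _ _ hP⟩
  · rintro k s ⟨τ, n⟩ ⟨υ, n'⟩ x' y' ⟨hn, hP⟩ hx hy
    obtain rfl : n = n' := hn
    replace hP : P (k + 1) τ υ := hP
    fin_cases s
    · obtain rfl : x' = (τ, n - 1) := (Equiv.eq_symm_apply (splitX0 T)).2 hx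
      obtain rfl : y' = (υ, n - 1) := (Equiv.eq_symm_apply (splitX0 T')).2 hy
      exact ⟨rfl, mono _ _ _ hP⟩
    · obtain rfl : x' = (splitX1 e).symm (τ, n) := (Equiv.eq_symm_apply (splitX1 e)).2 hx
      obtain rfl : y' = (splitX1 e').symm (υ, n) := (Equiv.eq_symm_apply (splitX1 e')).2 hy
      rcases lt_trichotomy n 0 with hn | rfl | hn
      · rw [splitX1_symm_of_neg e hn, splitX1_symm_of_neg e' hn]
        exact ⟨rfl, mono _ _ _ hP⟩
      · rw [splitX1_symm_zero, splitX1_symm_zero]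
        obtain ⟨h1, h2⟩ := parent _ _ _ hP
        rw [h1]
        exact ⟨rfl, h2⟩
      · rw [splitX1_symm_of_pos e hn, splitX1_symm_of_pos e' hn]
        exact ⟨rfl, mono _ _ _ hP⟩
  · rintro ⟨τ, n⟩ ⟨υ, m⟩ ⟨τ', n'⟩ ⟨υ', m'⟩ ⟨h1, h2⟩ ⟨h3, h4⟩
    have := uniq _ _ _ _ h2 h4
    simp only at h1 h3 this
    subst h1 h3
    change ((τ, n) : T × ℤ) = (τ', n') ↔ ((υ, n) : T' × ℤ) = (υ', n')
    simp only [Prod.mk.injEq, this]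

/-- The line, pointed at `0`. -/
def linePt (d : ℤ) : PointedGraph := ⟨lineGraph d, lineGraph_connected d, (0 : ℤ)⟩

/-- An arrow changes the integer coordinate by at most `1` as long as it stays on the line, so `n`
steps from such an `m` meet only positive coordinates, where every `x₁`-arrow is a loop. -/
theorem splitPt_ballIso_linePt_zero (h : (splitGraph e).Connected) {n : ℕ} (τ : T) {m : ℤ}
    (hm : n + 1 < m) : PointedGraph.BallIso n (splitPt e h τ m) (linePt 0) := by
  refine PointedGraph.ballIso_of_rel (Γ := splitPt e h τ m) (Δ := linePt 0)
    (R := fun k (x : T × ℤ) (y : ℤ) => x.1 = τ ∧ x.2 = y + m ∧ k < x.2) ?_ ?_ ?_ ?_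
    ⟨rfl, (zero_add m).symm, by exact_mod_cast hm⟩
  · rintro k x y ⟨h1, h2, h3⟩
    exact ⟨h1, h2, by omega⟩
  · rintro k s ⟨τ', n'⟩ y x' y' ⟨h1, h2, h3⟩ hx hy
    change ℤ at y
    simp only at h1 h2 h3
    subst h1
    fin_cases s
    · obtain rfl : (τ', n' + 1) = x' := hx
      obtain rfl : (y + 1 : ℤ) = y' := hy
      exact ⟨rfl, by simp only; omega, by simp only; omega⟩
    · obtain rfl : splitX1 e (τ', n') = x' := hx
      obtain rfl : (y + 0 : ℤ) = y' := hy
      rw [splitX1_of_pos e (by omega)]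
      exact ⟨rfl, by simp only; omega, by simp only; omega⟩
  · rintro k s ⟨τ', n'⟩ y x' y' ⟨h1, h2, h3⟩ hx hy
    change ℤ at y y'
    simp only at h1 h2 h3
    subst h1
    fin_cases s
    · obtain rfl : x' = (τ', n' - 1) := (Equiv.eq_symm_apply (splitX0 T)).2 hx
      replace hy : y' + 1 = y := hy
      exact ⟨rfl, by simp only; omega, by simp only; omega⟩
    · obtain rfl : x' = (splitX1 e).symm (τ', n') := (Equiv.eq_symm_apply (splitX1 e)).2 hx
      replace hy : y' + 0 = y := hy
      rw [splitX1_symm_of_pos e (by omega)]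
      exact ⟨rfl, by simp only; omega, by simp only; omega⟩
  · rintro ⟨τ₁, n₁⟩ y₁ ⟨τ₂, n₂⟩ y₂ ⟨h1, h2, -⟩ ⟨h3, h4, -⟩
    change ℤ at y₁ y₂
    simp only at h1 h2 h3 h4
    subst h1
    change ((τ₁, n₁) : T × ℤ) = (τ₂, n₂) ↔ y₁ = y₂
    simp only [Prod.mk.injEq, h3, true_and]
    omega

/-- Here the walk has to stay below the coordinate `-1`, where `x₁` branches off to another line;
this accounts for the extra `- 1` in the bound. -/
theorem splitPt_ballIso_linePt_one (h : (splitGraph e).Connected) {n : ℕ} (τ : T) {m : ℤ}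
    (hm : m < -(n + 1) - 1) : PointedGraph.BallIso n (splitPt e h τ m) (linePt 1) := by
  refine PointedGraph.ballIso_of_rel (Γ := splitPt e h τ m) (Δ := linePt 1)
    (R := fun k (x : T × ℤ) (y : ℤ) => x.1 = τ ∧ x.2 = y + m ∧ x.2 < -k - 1) ?_ ?_ ?_ ?_
    ⟨rfl, (zero_add m).symm, by exact_mod_cast hm⟩
  · rintro k x y ⟨h1, h2, h3⟩
    exact ⟨h1, h2, by omega⟩
  · rintro k s ⟨τ', n'⟩ y x' y' ⟨h1, h2, h3⟩ hx hy
    change ℤ at y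
    simp only at h1 h2 h3
    subst h1
    fin_cases s
    · obtain rfl : (τ', n' + 1) = x' := hx
      obtain rfl : (y + 1 : ℤ) = y' := hy
      exact ⟨rfl, by simp only; omega, by simp only; omega⟩
    · obtain rfl : splitX1 e (τ', n') = x' := hx
      obtain rfl : (y + 1 : ℤ) = y' := hy
      rw [splitX1_of_lt e (by omega)]
      exact ⟨rfl, by simp only; omega, by simp only; omega⟩
  · rintro k s ⟨τ', n'⟩ y x' y' ⟨h1, h2, h3⟩ hx hy
    change ℤ at y y'
    simp only at h1 h2 h3
    subst h1
    fin_cases s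
    · obtain rfl : x' = (τ', n' - 1) := (Equiv.eq_symm_apply (splitX0 T)).2 hx
      replace hy : y' + 1 = y := hy
      exact ⟨rfl, by simp only; omega, by simp only; omega⟩
    · obtain rfl : x' = (splitX1 e).symm (τ', n') := (Equiv.eq_symm_apply (splitX1 e)).2 hx
      replace hy : y' + 1 = y := hy
      rw [splitX1_symm_of_neg e (by omega)]
      exact ⟨rfl, by simp only; omega, by simp only; omega⟩
  · rintro ⟨τ₁, n₁⟩ y₁ ⟨τ₂, n₂⟩ y₂ ⟨h1, h2, -⟩ ⟨h3, h4, -⟩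
    change ℤ at y₁ y₂
    simp only at h1 h2 h3 h4
    subst h1
    change ((τ₁, n₁) : T × ℤ) = (τ₂, n₂) ↔ y₁ = y₂
    simp only [Prod.mk.injEq, h3, true_and]
    omega

end Splitting

/-! ### Isomorphisms between graphs of splittings -/

section Rigidity

variable {T : Type} {e : T ≃ Bool × T} {T' : Type} {e' : T' ≃ Bool × T'}

/-- Commuting with `x₀` forces an isomorphism to move each line `{τ} × ℤ` rigidly, by a shift, to a
line. -/
theorem exists_equiv_of_iso {h : (splitGraph e).Connected} {h' : (splitGraph e').Connected}
    {τ : T} {υ : T'} {m m' : ℤ}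
    (hi : PointedGraph.Iso (splitPt e h τ m) (splitPt e' h' υ m')) :
    ∃ φ : T × ℤ → T' × ℤ, φ (τ, m) = (υ, m') ∧
      (∀ τ n (j : ℤ), φ (τ, n + j) = ((φ (τ, n)).1, (φ (τ, n)).2 + j)) ∧
      (∀ p, φ (splitX1 e p) = splitX1 e' (φ p)) ∧ Function.Injective φ := by
  obtain ⟨φ, hb, hφ⟩ := hi
  change T × ℤ ≃ T' × ℤ at φ
  have h0 : ∀ τ n, φ (τ, n + 1) = ((φ (τ, n)).1, (φ (τ, n)).2 + 1) := fun τ n =>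
    ((hφ 0 (τ, n) (τ, n + 1)).1 rfl).symm
  refine ⟨φ, hb, fun τ n j => ?_, fun p => ((hφ 1 p _).1 rfl).symm, φ.injective⟩
  induction j using Int.induction_on with
  | zero => simp
  | succ j ih => rw [← add_assoc, h0, ih, add_assoc]
  | pred j ih =>
    have h1 := h0 τ (n + (-(j : ℤ) - 1))
    rw [show n + (-(j : ℤ) - 1) + 1 = n + -j by ring, ih] at h1
    refine Prod.ext (congrArg Prod.fst h1).symm ?_
    have h2 := congrArg Prod.snd h1
    simp only at h2 ⊢
    omega

/-- The loops make the sign of the integer coordinate visible in the abstract graph; `he` excludes a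
loop at coordinate `0`. -/
theorem splitX1_eq_self_iff (he : ∀ b τ, e.symm (b, τ) ≠ τ) (p : T × ℤ) :
    splitX1 e p = p ↔ 0 < p.2 := by
  obtain ⟨τ, n⟩ := p
  refine ⟨fun h => ?_, fun h => splitX1_of_pos e h⟩
  by_contra hn
  replace hn : n ≤ 0 := not_lt.1 hn
  rcases eq_or_ne n 0 with rfl | h0
  · rw [splitX1_zero] at h
    exact he _ _ (congrArg Prod.fst h)
  rcases eq_or_ne n (-1) with rfl | h1
  · rw [splitX1_neg_one] at h
    exact he _ _ (congrArg Prod.fst h)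
  · rw [splitX1_of_lt e (by omega)] at h
    have := congrArg Prod.snd h
    simp only at this
    omega

/-- Without loops at the grey vertices, an isomorphism preserves the second coordinate, the letters
and the parents. -/
theorem exists_map_of_iso (he : ∀ b τ, e.symm (b, τ) ≠ τ) (he' : ∀ b τ, e'.symm (b, τ) ≠ τ)
    {h : (splitGraph e).Connected} {h' : (splitGraph e').Connected} {τ : T} {υ : T'} {m m' : ℤ}
    (hi : PointedGraph.Iso (splitPt e h τ m) (splitPt e' h' υ m')) :
    m = m' ∧ ∃ ψ : T → T', ψ τ = υ ∧
      ∀ τ, (e' (ψ τ)).1 = (e τ).1 ∧ (e' (ψ τ)).2 = ψ (e τ).2 := by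
  obtain ⟨φ, hb, h0, h1, hinj⟩ := exists_equiv_of_iso hi
  have hpos : ∀ p, 0 < (φ p).2 ↔ 0 < p.2 := fun p => by
    rw [← splitX1_eq_self_iff he, ← splitX1_eq_self_iff he', ← h1]
    exact ⟨fun h => hinj h, fun h => congrArg φ h⟩
  have hsnd : ∀ τ n, (φ (τ, n)).2 = n := fun τ n => by
    -- On each line `φ` is a shift that preserves positivity; testing the coordinates `1` and `0`
    -- shows that the shift is zero.
    have h2 := hpos (τ, n + (1 - n))
    have h3 := hpos (τ, n + -n)
    rw [h0] at h2 h3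
    simp only at h2 h3
    omega
  have hφ : ∀ τ n, φ (τ, n) = ((φ (τ, 0)).1, n) := fun τ n => by
    have h2 := h0 τ 0 n
    rw [hsnd, zero_add] at h2
    exact h2
  have hm : m = m' := by
    rw [← hsnd τ m, hb]
  refine ⟨hm, fun τ => (φ (τ, 0)).1, ?_, fun τ => ?_⟩
  · rw [hφ] at hb
    exact congrArg Prod.fst hb
  · have h2 : (splitX1 e').symm (φ (τ, 0)) = φ ((splitX1 e).symm (τ, 0)) := by
      rw [Equiv.symm_apply_eq, ← h1, Equiv.apply_symm_apply]
    rw [splitX1_symm_zero, hφ, hφ τ, splitX1_symm_zero] at h2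
    refine ⟨?_, (congrArg Prod.fst h2 :).trans
      (congrArg Prod.fst (hφ (e τ).2 (if (e τ).1 then -1 else 0)) :)⟩
    have h3 : (if (e' (φ (τ, 0)).1).1 then (-1 : ℤ) else 0) = if (e τ).1 then -1 else 0 :=
      (congrArg Prod.snd h2).trans (hsnd _ _)
    change (e' (φ (τ, 0)).1).1 = (e τ).1
    generalize (e' (φ (τ, 0)).1).1 = b at h3 ⊢
    generalize (e τ).1 = c at h3 ⊢
    cases b <;> cases c <;> simp at h3 ⊢

/-- A graph with a loop at a grey vertex is not isomorphic to one without such loops. -/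
theorem not_iso_of_loop (he : ∀ b τ, e.symm (b, τ) ≠ τ) {o : T'} (ho : e'.symm (false, o) = o)
    {h : (splitGraph e).Connected} {h' : (splitGraph e').Connected} {τ : T} {υ : T'} {m m' : ℤ} :
    ¬ PointedGraph.Iso (splitPt e' h' υ m') (splitPt e h τ m) := by
  intro hi
  obtain ⟨φ, -, h0, h1, hinj⟩ := exists_equiv_of_iso hi
  have hpos : ∀ p, 0 < (φ p).2 ↔ splitX1 e' p = p := fun p => by
    rw [← splitX1_eq_self_iff he, ← h1]
    exact ⟨fun h => hinj h, fun h => congrArg φ h⟩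
  -- The vertex `(o, 0)` has a loop and `(o, -1)` has none, so their images have coordinates `1` and
  -- `0`, and `(o, -2)` goes to coordinate `-1`. The `x₁`-arrow from `(o, -2)` to `(o, -1)` stays on
  -- its line, whereas the one from coordinate `-1` of the target graph goes to a child, that is, to
  -- another line.
  have h2 : 0 < (φ (o, 0)).2 := (hpos _).2 (by rw [splitX1_zero, ho])
  have h3 : ¬ 0 < (φ (o, 0 + -1)).2 := by
    rw [hpos, zero_add, splitX1_neg_one]
    intro h
    simpa using congrArg Prod.snd h
  have h4 := h1 (o, 0 + -2)
  rw [splitX1_of_lt e' (by omega), add_assoc, h0, h0] at h4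
  rw [h0] at h3
  have h5 : (φ (o, 0)).2 + -2 = -1 := by simp only at h3; omega
  rw [h5, splitX1_neg_one] at h4
  exact he _ _ (congrArg Prod.fst h4).symm

/-- A line of a splitting has both `x₁`-loops, at positive coordinates, and `x₁`-arrows that are not
loops, whereas in `linePt d` either all the `x₁`-arrows are loops or none is. -/
theorem not_iso_linePt {d : ℤ} (hd : d = 0 ∨ d = 1) {h : (splitGraph e).Connected} {τ : T}
    {m : ℤ} : ¬ PointedGraph.Iso (splitPt e h τ m) (linePt d) := by
  rintro ⟨φ, hb, hφ⟩
  change T × ℤ ≃ ℤ at φ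
  have h0 : ∀ τ n, φ (τ, n) + 1 = φ (τ, n + 1) := fun τ n => (hφ 0 (τ, n) (τ, n + 1)).1 rfl
  have h1 : ∀ p, φ p + d = φ (splitX1 e p) := fun p => (hφ 1 p _).1 rfl
  rcases hd with rfl | rfl
  · have h2 := h1 (τ, -1)
    rw [add_zero, φ.apply_eq_iff_eq, splitX1_neg_one] at h2
    simpa using congrArg Prod.snd h2
  · have h2 := h1 (τ, 1)
    rw [splitX1_of_pos e one_pos] at h2
    omega

theorem not_iso_linePt_linePt : ¬ PointedGraph.Iso (linePt 0) (linePt 1) := by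
  rintro ⟨φ, hb, hφ⟩
  change ℤ ≃ ℤ at φ
  have h1 : φ 0 + 1 = φ 0 := (hφ 1 (0 : ℤ) (0 : ℤ)).1 rfl
  omega

end Rigidity

/-! ### The graphs of type B as graphs of splittings -/

theorem Tree.ext {w : ℕ → Bool} {τ υ : Tree w} (h1 : τ.1.1 = υ.1.1) (h2 : τ.1.2 = υ.1.2) :
    τ = υ := Subtype.ext (Prod.ext h1 h2)

/-- A vertex of the tree is given by its first letter and its parent. -/
def treeEquiv (w : ℕ → Bool) : Tree w ≃ Bool × Tree w where
  toFun τ := (τ.1.2 0, τ.parent)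
  invFun p := p.2.child p.1
  left_inv τ := Tree.child_parent _ τ rfl
  right_inv _ := Prod.ext rfl (Tree.parent_child _ _)

theorem treeEquiv_symm_level {w : ℕ → Bool} (b : Bool) (τ : Tree w) :
    ((treeEquiv w).symm (b, τ)).1.1 = τ.1.1 - 1 := rfl

theorem treeEquiv_symm_ne (w : ℕ → Bool) (b : Bool) (τ : Tree w) :
    (treeEquiv w).symm (b, τ) ≠ τ := fun h => by
  have : τ.1.1 - 1 = τ.1.1 := congrArg (fun τ : Tree w => τ.1.1) h
  omega

/-- The pointed graph of type B with upward path `v` from the line of the base vertex. -/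
def treePt (v : ℕ → Bool) (n : ℤ) : PointedGraph :=
  splitPt (treeEquiv v) (treeGraph_connected v) (spine v 0) n

/-- Changing the upward path from the level `N` on. -/
theorem treePt_ballIso {v v' : ℕ → Bool} {n : ℕ} (h : ∀ i < n + 1, v i = v' i) (m : ℤ) :
    PointedGraph.BallIso n (treePt v m) (treePt v' m) := by
  refine splitPt_ballIso (e := treeEquiv v) (e' := treeEquiv v') _ _
    -- Related vertices have the same level, with `k` further steps up allowed before passing level
    -- `n + 1`. Below that level their letters agree; from it on, each sequence is the prescribed
    -- one, `v` or `v'`, so either vertex determines the other.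
    (P := fun k τ υ => τ.1.1 = υ.1.1 ∧ τ.1.1 + k ≤ (n + 1 : ℕ) ∧
      (∀ j : ℕ, τ.1.1 + j < (n + 1 : ℕ) → τ.1.2 j = υ.1.2 j) ∧
      (∀ i j : ℕ, n + 1 ≤ i → i = τ.1.1 + j → τ.1.2 j = v i) ∧
      (∀ i j : ℕ, n + 1 ≤ i → i = υ.1.1 + j → υ.1.2 j = v' i)) ?_ ?_ ?_ ?_ ?_ m
  · rintro k τ υ ⟨h1, h2, h3⟩
    exact ⟨h1, by push_cast at h2; omega, h3⟩
  · rintro k b τ υ ⟨h1, h2, h3, h4, h5⟩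
    refine ⟨congrArg (· - 1) h1, by rw [treeEquiv_symm_level]; push_cast at h2; omega,
      ?_, ?_, ?_⟩
    · rintro (_ | j) hj
      · rfl
      · refine h3 j ?_
        rw [treeEquiv_symm_level] at hj; push_cast at hj
        omega
    · rintro i (_ | j) hi hj
      · rw [treeEquiv_symm_level] at hj; push_cast at hj
        omega
      · refine h4 i j hi ?_
        rw [treeEquiv_symm_level] at hj; push_cast at hj
        omega
    · rintro i (_ | j) hi hj
      · rw [treeEquiv_symm_level] at hj; push_cast at hj
        omega
      · refine h5 i j hi ?_
        rw [treeEquiv_symm_level] at hj; push_cast at hj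
        omega
  · rintro k τ υ ⟨h1, h2, h3, h4, h5⟩
    refine ⟨h3 0 (by push_cast at h2 ⊢; omega), congrArg (· + 1) h1, ?_, ?_, ?_, ?_⟩
    · simp only [treeEquiv, Equiv.coe_fn_mk, Tree.parent]
      push_cast at h2 ⊢
      omega
    · intro j hj
      refine h3 (j + 1) ?_
      simp only [treeEquiv, Equiv.coe_fn_mk, Tree.parent] at hj
      push_cast at hj ⊢
      omega
    · intro i j hi hj
      refine h4 i (j + 1) hi ?_
      simp only [treeEquiv, Equiv.coe_fn_mk, Tree.parent] at hj
      push_cast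
      omega
    · intro i j hi hj
      refine h5 i (j + 1) hi ?_
      simp only [treeEquiv, Equiv.coe_fn_mk, Tree.parent] at hj
      push_cast
      omega
  · rintro τ υ τ' υ' ⟨h1, h2, h3, h4, h5⟩ ⟨h1', h2', h3', h4', h5'⟩
    constructor
    · rintro rfl
      refine Tree.ext (h1.symm.trans h1') (funext fun j => ?_)
      rcases lt_or_ge (τ.1.1 + j) (n + 1 : ℕ) with hj | hj
      · rw [← h3 j hj, ← h3' j hj]
      · rw [h5 (τ.1.1 + j).toNat j (by omega) (by omega),
          h5' (τ.1.1 + j).toNat j (by omega) (by omega)]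
    · rintro rfl
      refine Tree.ext (h1.trans h1'.symm) (funext fun j => ?_)
      rcases lt_or_ge (τ.1.1 + j) (n + 1 : ℕ) with hj | hj
      · rw [h3 j hj, ← h3' j (by omega)]
      · rw [h4 (τ.1.1 + j).toNat j (by omega) (by omega),
          h4' (τ.1.1 + j).toNat j (by omega) (by omega)]
  · refine ⟨rfl, by simp [spine], fun j hj => ?_, fun i j hi hij => ?_, fun i j hi hij => ?_⟩
    · simp only [spine, Nat.zero_add]
      refine h j ?_
      simp only [spine] at hj
      omega
    · obtain rfl : i = j := by simpa [spine] using hij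
      simp [spine]
    · obtain rfl : i = j := by simpa [spine] using hij
      simp [spine]

/-- Shifting all levels by that of `τ₀` matches the tree with the one built on the sequence going up
from `τ₀`. So a pointed graph of type B depends only on this sequence and on `m`. -/
theorem splitPt_tree_iso (w : ℕ → Bool) (h : (splitGraph (treeEquiv w)).Connected) (τ₀ : Tree w)
    (m : ℤ) : PointedGraph.Iso (splitPt (treeEquiv w) h τ₀ m) (treePt τ₀.1.2 m) := by
  refine PointedGraph.iso_of_ballIso fun n => ?_
  refine splitPt_ballIso (e := treeEquiv w) (e' := treeEquiv τ₀.1.2) _ _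
    (P := fun k τ υ => τ.1.1 = υ.1.1 + τ₀.1.1 ∧ τ.1.2 = υ.1.2) ?_ ?_ ?_ ?_ ?_ m
  · exact fun _ _ _ h => h
  · rintro k b τ υ ⟨h1, h2⟩
    refine ⟨?_, ?_⟩
    · rw [treeEquiv_symm_level, treeEquiv_symm_level]
      omega
    · exact funext fun j => by cases j with
      | zero => rfl
      | succ j => exact congrFun h2 j
  · rintro k τ υ ⟨h1, h2⟩
    refine ⟨congrFun h2 0, ?_, ?_⟩
    · simp only [treeEquiv, Equiv.coe_fn_mk, Tree.parent]
      omega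
    · simp only [treeEquiv, Equiv.coe_fn_mk, Tree.parent, h2]
  · rintro τ υ τ' υ' ⟨h1, h2⟩ ⟨h1', h2'⟩
    constructor
    · rintro rfl
      exact Tree.ext (by omega) (h2.symm.trans h2')
    · rintro rfl
      exact Tree.ext (by omega) (h2.trans h2'.symm)
  · exact ⟨by simp [spine], by simp [spine]⟩

/-- An isomorphism preserves first letters and parents, and the upward word of the base is read off
by passing to parents repeatedly. -/
theorem treePt_injective {v v' : ℕ → Bool} {m m' : ℤ}
    (h : PointedGraph.Iso (treePt v m) (treePt v' m')) : v = v' ∧ m = m' := by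
  obtain ⟨hm, ψ, h0, hψ⟩ := exists_map_of_iso (treeEquiv_symm_ne v) (treeEquiv_symm_ne v') h
  refine ⟨funext fun j => ?_, hm⟩
  have key : ∀ (j : ℕ) (τ : Tree v), (ψ τ).1.2 j = τ.1.2 j := by
    intro j
    induction j with
    | zero => exact fun τ => (hψ τ).1
    | succ j ih =>
      intro τ
      have h1 : (ψ τ).parent = ψ τ.parent := (hψ τ).2
      have h2 := ih τ.parent
      rw [← h1] at h2
      exact h2
  have h1 := key j (spine v 0)
  rw [h0] at h1
  simpa [spine] using h1.symm

theorem typeB_eq : typeB = {g | ∃ v n, g = GraphSpace.mk (treePt v n)} := by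
  ext g
  constructor
  · rintro ⟨w, ⟨τ, n⟩, rfl⟩
    exact ⟨τ.1.2, n, Quotient.sound (splitPt_tree_iso w _ τ n)⟩
  · rintro ⟨v, n, rfl⟩
    exact ⟨v, (spine v 0, n), rfl⟩

theorem typeC_eq : typeC = {GraphSpace.mk (linePt 0), GraphSpace.mk (linePt 1)} := rfl

open Filter Topology

/-! ### A parametrization of the graphs of types B and C by the Cantor set -/

/-- The number of zeros in the code of a vertex at the position `n` of its line. -/
def depth (n : ℤ) : ℕ := if 0 < n then (n - 1).toNat else (-n).toNat

theorem depth_of_pos {n : ℤ} (h : 0 < n) : (depth n : ℤ) = n - 1 := by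
  simp only [depth, h, if_true]
  omega

theorem depth_of_nonpos {n : ℤ} (h : n ≤ 0) : (depth n : ℤ) = -n := by
  simp only [depth, not_lt.2 h, if_false]
  omega

theorem eq_of_depth_eq {n n' : ℤ} (h : depth n = depth n') (h' : 0 < n ↔ 0 < n') : n = n' := by
  rcases lt_or_ge 0 n with hn | hn
  · have h1 := depth_of_pos hn
    have h2 := depth_of_pos (h'.1 hn)
    omega
  · have h1 := depth_of_nonpos hn
    have h2 := depth_of_nonpos (not_lt.1 fun h => absurd (h'.2 h) (not_lt.2 hn))
    omega

/-- The word `b0ᵏ1v` is the code of the pair `(v, n)`, where `b` encodes the sign of `n` and `k` is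
the depth of `n`. -/
structure IsCode (x v : ℕ → Bool) (n : ℤ) : Prop where
  sign : x 0 = true ↔ 0 < n
  zeros : ∀ j < depth n, x (j + 1) = false
  one : x (depth n + 1) = true
  word : ∀ i, x (depth n + 2 + i) = v i

theorem exists_isCode_of_exists {x : ℕ → Bool} (h : ∃ j, x (j + 1) = true) :
    ∃ v n, IsCode x v n := by
  classical
  set k := Nat.find h with hk
  have h1 : x (k + 1) = true := Nat.find_spec h
  have h2 : ∀ j < k, x (j + 1) = false := fun j hj => by simpa using Nat.find_min h hj
  -- The integers of depth `k` are `k + 1` and `-k`; the letter `x 0` chooses between them.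
  refine ⟨fun i => x (k + 2 + i), if x 0 then k + 1 else -k, ?_⟩
  have h3 : depth (if x 0 then k + 1 else -k) = k := by
    split_ifs
    · have := depth_of_pos (n := k + 1) (by omega)
      omega
    · have := depth_of_nonpos (n := -k) (by omega)
      omega
  refine ⟨?_, by rwa [h3], by rwa [h3], by rw [h3]; exact fun _ => rfl⟩
  split_ifs with h0
  · simp only [h0, true_iff]
    omega
  · simp only [h0]
    simp

theorem exists_isCode (v : ℕ → Bool) (n : ℤ) : ∃ x, IsCode x v n := by
  refine ⟨fun i => if i = 0 then decide (0 < n) else if i < depth n + 1 then false else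
    if i = depth n + 1 then true else v (i - (depth n + 2)), ?_, fun j hj => ?_, ?_, fun i => ?_⟩
  · simp
  · simp [hj]
  · simp
  · have h1 : ¬ depth n + 2 + i < depth n + 1 := by omega
    have h2 : ¬ depth n + 2 + i = depth n + 1 := by omega
    simp [h1, h2]

namespace IsCode

variable {x x' v v' : ℕ → Bool} {n n' : ℤ}

theorem exists_eq_true (h : IsCode x v n) : ∃ j, x (j + 1) = true := ⟨_, h.one⟩

theorem depth_le (h : IsCode x v n) {j : ℕ} (hj : x (j + 1) = true) : depth n ≤ j := by
  by_contra hlt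
  simp [h.zeros j (not_le.1 hlt)] at hj

theorem unique (h : IsCode x v n) (h' : IsCode x v' n') : v = v' ∧ n = n' := by
  have h1 : depth n = depth n' := le_antisymm (h.depth_le h'.one) (h'.depth_le h.one)
  have h2 : n = n' := eq_of_depth_eq h1 (h.sign.symm.trans h'.sign)
  subst h2
  exact ⟨funext fun i => (h.word i).symm.trans (h'.word i), rfl⟩

theorem eq (h : IsCode x v n) (h' : IsCode x' v n) : x = x' := by
  funext i
  rcases i with _ | i
  · exact Bool.eq_iff_iff.2 (h.sign.trans h'.sign.symm)
  · rcases lt_trichotomy i (depth n) with hi | rfl | hi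
    · rw [h.zeros i hi, h'.zeros i hi]
    · rw [h.one, h'.one]
    · obtain ⟨j, rfl⟩ := Nat.exists_eq_add_of_lt hi
      rw [show depth n + j + 1 + 1 = depth n + 2 + j by ring, h.word, h'.word]

end IsCode

open Classical in
/-- The pointed graph with a given code. -/
noncomputable def decode (x : ℕ → Bool) : GraphSpace :=
  if h : ∃ p : (ℕ → Bool) × ℤ, IsCode x p.1 p.2 then
    GraphSpace.mk (treePt h.choose.1 h.choose.2)
  else GraphSpace.mk (linePt (if x 0 then 0 else 1))

theorem IsCode.decode_eq {x v : ℕ → Bool} {n : ℤ} (h : IsCode x v n) :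
    decode x = GraphSpace.mk (treePt v n) := by
  have h' : ∃ p : (ℕ → Bool) × ℤ, IsCode x p.1 p.2 := ⟨(v, n), h⟩
  rw [decode, dif_pos h']
  obtain ⟨h1, h2⟩ := h'.choose_spec.unique h
  rw [h1, h2]

theorem decode_of_forall {x : ℕ → Bool} (h : ∀ j, x (j + 1) = false) :
    decode x = GraphSpace.mk (linePt (if x 0 then 0 else 1)) := by
  refine dif_neg ?_
  rintro ⟨p, hp⟩
  obtain ⟨j, hj⟩ := hp.exists_eq_true
  simp [h j] at hj

theorem code_cases (x : ℕ → Bool) :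
    (∃ v n, IsCode x v n) ∨ ∀ j, x (j + 1) = false := by
  by_cases h : ∃ j, x (j + 1) = true
  · exact Or.inl (exists_isCode_of_exists h)
  · right
    simpa using h

theorem GraphSpace.mk_eq_iff {Γ Δ : PointedGraph} :
    GraphSpace.mk Γ = GraphSpace.mk Δ ↔ PointedGraph.Iso Γ Δ := Quotient.eq

theorem decode_injective : Function.Injective decode := by
  have key : ∀ x x', (∃ v n, IsCode x v n) → (∀ j, x' (j + 1) = false) → decode x ≠ decode x' := by
    rintro x x' ⟨v, n, h⟩ h' hxx
    rw [h.decode_eq, decode_of_forall h', GraphSpace.mk_eq_iff] at hxx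
    refine not_iso_linePt ?_ hxx
    split_ifs <;> simp
  intro x x' hxx
  rcases code_cases x with ⟨v, n, h⟩ | h <;> rcases code_cases x' with ⟨v', n', h'⟩ | h'
  · rw [h.decode_eq, h'.decode_eq, GraphSpace.mk_eq_iff] at hxx
    obtain ⟨rfl, rfl⟩ := treePt_injective hxx
    exact h.eq h'
  · exact absurd hxx (key _ _ ⟨v, n, h⟩ h')
  · exact absurd hxx.symm (key _ _ ⟨v', n', h'⟩ h)
  · rw [decode_of_forall h, decode_of_forall h', GraphSpace.mk_eq_iff] at hxx
    have h0 : x 0 = x' 0 := by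
      rcases hx : x 0 <;> rcases hx' : x' 0
      · rfl
      · simp only [hx, hx'] at hxx
        exact absurd hxx.symm not_iso_linePt_linePt
      · simp only [hx, hx'] at hxx
        exact absurd hxx not_iso_linePt_linePt
      · rfl
    funext i
    rcases i with _ | i
    · exact h0
    · rw [h, h']

theorem range_decode : Set.range decode = typeB ∪ typeC := by
  rw [typeB_eq, typeC_eq]
  ext g
  constructor
  · rintro ⟨x, rfl⟩
    rcases code_cases x with ⟨v, n, h⟩ | h
    · exact Or.inl ⟨v, n, h.decode_eq⟩
    · right
      rw [decode_of_forall h]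
      split_ifs <;> simp
  · rintro (⟨v, n, rfl⟩ | rfl | rfl)
    · obtain ⟨x, hx⟩ := exists_isCode v n
      exact ⟨x, hx.decode_eq⟩
    · exact ⟨fun i => decide (i = 0), decode_of_forall fun j => by simp⟩
    · exact ⟨fun i => false, decode_of_forall fun j => by simp⟩

/-! ### Continuity of the parametrization -/

theorem eventually_agree (x : ℕ → Bool) (N : ℕ) : ∀ᶠ x' in 𝓝 x, ∀ i < N, x' i = x i := by
  refine (Set.finite_lt_nat N).eventually_all.2 fun i _ => ?_
  exact (continuous_apply i).continuousAt.eventually_mem (by simp : {x i} ∈ 𝓝 (x i))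

/-- Near a code with a `1` after the sign letter, the position `n` is constant and the words share a
long prefix. Near `b000…`, the depth is large, so the base lies far out on its line, where the graph
looks like the limit line. -/
theorem ballIso_decode_of_agree (x : ℕ → Bool) (r : ℕ) :
    ∃ N, ∀ x', (∀ i < N, x' i = x i) → GraphSpace.BallIso r (decode x') (decode x) := by
  rcases code_cases x with ⟨v, n, h⟩ | h
  · refine ⟨depth n + 2 + (r + 1), fun x' hx => ?_⟩
    have h' : IsCode x' (fun i => x' (depth n + 2 + i)) n := by
      refine ⟨?_, fun j hj => ?_, ?_, fun _ => rfl⟩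
      · rw [hx 0 (by omega)]
        exact h.sign
      · rw [hx _ (by omega)]
        exact h.zeros j hj
      · rw [hx _ (by omega)]
        exact h.one
    rw [h.decode_eq, h'.decode_eq]
    refine treePt_ballIso (fun i hi => ?_) n
    rw [hx _ (by omega), h.word]
  -- Agreement on `r + 4` letters forces depth at least `r + 3`, which is just enough for
  -- nonpositive `n'`, where `n' < -(r + 1) - 1` is required.
  · refine ⟨r + 4, fun x' hx => ?_⟩
    have h0 : x' 0 = x 0 := hx 0 (by omega)
    rw [decode_of_forall h]
    rcases code_cases x' with ⟨v', n', h'⟩ | h'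
    · rw [h'.decode_eq]
      have hd : r + 3 ≤ depth n' := by
        by_contra hd
        have h1 := h'.one
        rw [hx _ (by omega), h] at h1
        exact absurd h1 (by simp)
      have hs := h'.sign
      rw [h0] at hs
      split_ifs with hx0
      · have h1 := hs.1 hx0
        have h2 := depth_of_pos h1
        exact splitPt_ballIso_linePt_zero _ _ _ (by omega)
      · have h1 : n' ≤ 0 := not_lt.1 fun h => hx0 (hs.2 h)
        have h2 := depth_of_nonpos h1
        exact splitPt_ballIso_linePt_one _ _ _ (by omega)
    · rw [decode_of_forall h', h0]
      exact GraphSpace.BallIso.refl _ _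

theorem continuous_decode : Continuous decode := by
  refine continuous_iff_continuousAt.2 fun x => Metric.tendsto_nhds.2 fun ε hε => ?_
  obtain ⟨r, hr⟩ := exists_pow_lt_of_lt_one hε (by norm_num : (1 / 2 : ℝ) < 1)
  obtain ⟨N, hN⟩ := ballIso_decode_of_agree x r
  filter_upwards [eventually_agree x N] with x' hx'
  exact ((GraphSpace.dist_le_iff _ _ r).2 (hN x' hx')).trans_lt hr

/-! ### The Schreier graph of the dyadic rationals as the graph of a splitting -/

/-- Binary words with finitely many letters `1`. -/
def FinWord : Type := {v : ℕ → Bool // ∃ N, ∀ i, N ≤ i → v i = false}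

namespace FinWord

/-- The word without its first letter. -/
def tail (v : FinWord) : FinWord :=
  ⟨fun i => v.1 (i + 1), by
    obtain ⟨N, hN⟩ := v.2
    exact ⟨N, fun i hi => hN _ (by omega)⟩⟩

/-- The word with an additional first letter. -/
def cons (b : Bool) (v : FinWord) : FinWord :=
  ⟨fun i => Nat.casesOn i b v.1, by
    obtain ⟨N, hN⟩ := v.2
    refine ⟨N + 1, fun i hi => ?_⟩
    obtain _ | i := i
    · omega
    · exact hN i (by omega)⟩

/-- The word without letters `1`. -/
def zero : FinWord := ⟨fun _ => false, 0, fun _ _ => rfl⟩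

/-- A word is given by its first letter and the rest. -/
def splitEquiv : FinWord ≃ Bool × FinWord where
  toFun v := (v.1 0, v.tail)
  invFun p := p.2.cons p.1
  left_inv v := Subtype.ext (funext fun i => by cases i <;> rfl)
  right_inv _ := rfl

theorem splitEquiv_symm_zero : splitEquiv.symm (false, zero) = zero :=
  Subtype.ext (funext fun i => by cases i <;> rfl)

/-- The number with a given binary expansion. -/
noncomputable def value (v : FinWord) : ℝ := ∑' i, (if v.1 i then 1 else 0) * (1 / 2 : ℝ) ^ (i + 1)

theorem summable_value (v : FinWord) :
    Summable fun i => (if v.1 i then 1 else 0) * (1 / 2 : ℝ) ^ (i + 1) := by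
  obtain ⟨N, hN⟩ := v.2
  refine summable_of_ne_finset_zero (s := Finset.range N) fun i hi => ?_
  simp [hN i (by simpa using hi)]

theorem value_eq (v : FinWord) : v.value = ((if v.1 0 then 1 else 0) + v.tail.value) / 2 := by
  rw [value, v.summable_value.tsum_eq_zero_add, value, add_div, ← tsum_div_const]
  congr 1
  · simp [div_eq_mul_inv]
  · refine tsum_congr fun i => ?_
    change (if v.1 (i + 1) then (1 : ℝ) else 0) * (1 / 2) ^ (i + 1 + 1) =
      (if v.1 (i + 1) then (1 : ℝ) else 0) * (1 / 2) ^ (i + 1) / 2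
    ring

theorem value_cons (b : Bool) (v : FinWord) :
    (v.cons b).value = ((if b then 1 else 0) + v.value) / 2 := value_eq (v.cons b)

theorem value_zero : zero.value = 0 := by simp [value, zero]

theorem eq_zero_of_forall {v : FinWord} (h : ∀ i, 0 ≤ i → v.1 i = false) : v = zero :=
  Subtype.ext (funext fun i => h i (Nat.zero_le _))

/-- Induction on the number of letters before the tail of letters `0`. -/
theorem induction {p : FinWord → Prop} (h0 : p zero) (h : ∀ v : FinWord, p v.tail → p v)
    (v : FinWord) : p v := by
  obtain ⟨N, hN⟩ := v.2
  induction N generalizing v with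
  | zero => rwa [eq_zero_of_forall hN]
  | succ N ih => exact h v (ih v.tail fun i hi => hN (i + 1) (by omega))

theorem value_mem (v : FinWord) : 0 ≤ v.value ∧ v.value < 1 := by
  induction v using FinWord.induction with
  | h0 => simp [value_zero]
  | h v ih =>
    rw [value_eq]
    split_ifs <;> constructor <;> linarith

/-- Values lie in `[0, 1)`, the end `1` being excluded because the letters `1` are finitely many. So
the first letter tells whether the value is at least `1/2`, and the rest follows by passing to
tails. -/
theorem value_injective : Function.Injective value := by
  have key : ∀ (i : ℕ) (v v' : FinWord), v.value = v'.value → v.1 i = v'.1 i := by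
    intro i
    induction i with
    | zero =>
      intro v v' h
      have h1 := v.tail.value_mem
      have h2 := v'.tail.value_mem
      rw [value_eq, value_eq v'] at h
      rcases h3 : v.1 0 <;> rcases h4 : v'.1 0 <;> simp [h3, h4] at h ⊢ <;> linarith
    | succ i ih =>
      intro v v' h
      have h0 : v.1 0 = v'.1 0 := by
        have h1 := v.tail.value_mem
        have h2 := v'.tail.value_mem
        rw [value_eq, value_eq v'] at h
        rcases h3 : v.1 0 <;> rcases h4 : v'.1 0 <;> simp [h3, h4] at h ⊢ <;> linarith
      refine ih v.tail v'.tail ?_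
      rw [value_eq, value_eq v', h0] at h
      linarith
  exact fun v v' h => Subtype.ext (funext fun i => key i v v' h)

end FinWord

open FinWord

/-! ### Connectedness of the graph of words, and numerical labels -/

theorem finWord_reach (v : FinWord) (n : ℤ) :
    Relation.ReflTransGen (splitGraph splitEquiv).Link ((v, n) : FinWord × ℤ)
      ((zero, 0) : FinWord × ℤ) := by
  have h0 : ∀ (v : FinWord) (n : ℤ), Relation.ReflTransGen (splitGraph splitEquiv).Link
      ((v, n) : FinWord × ℤ) ((v, 0) : FinWord × ℤ) := by
    intro v n
    induction n using Int.induction_on with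
    | zero => exact Relation.ReflTransGen.refl
    | succ n ih =>
      refine Relation.ReflTransGen.head ⟨0, Or.inr ?_⟩ ih
      rfl
    | pred n ih =>
      refine Relation.ReflTransGen.head ⟨0, Or.inl ?_⟩ ih
      exact (splitX0 FinWord).apply_symm_apply ((v, -n) : FinWord × ℤ)
  refine (h0 v n).trans ?_
  induction v using FinWord.induction with
  | h0 => exact Relation.ReflTransGen.refl
  | h v ih =>
    refine Relation.ReflTransGen.head ⟨1, Or.inr ?_⟩ ((h0 v.tail (if v.1 0 then -1 else 0)).trans ih)
    change splitX1 splitEquiv (v.tail, if v.1 0 then -1 else 0) = (v, 0)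
    rw [← Equiv.eq_symm_apply, splitX1_symm_zero]
    rfl

theorem finWord_connected : (splitGraph splitEquiv).Connected :=
  MarkedGraph.connected_of_reach (G := splitGraph splitEquiv) ((zero, 0) : FinWord × ℤ)
    fun p => finWord_reach p.1 p.2

/-- The least number whose binary expansion is the label of a vertex at the position `n`. -/
noncomputable def lower (n : ℤ) : ℝ := if 0 < n then 2 ^ (-n - 1) else 1 - 2 ^ (n - 1)

theorem lower_of_pos {n : ℤ} (h : 0 < n) : lower n = 2 ^ (-n - 1) := if_pos h

theorem lower_of_nonpos {n : ℤ} (h : n ≤ 0) : lower n = 1 - 2 ^ (n - 1) := if_neg (not_lt.2 h)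

theorem lower_zero : lower 0 = 1 / 2 := by norm_num [lower]

theorem lower_neg_one : lower (-1) = 3 / 4 := by norm_num [lower]

theorem lower_neg_two : lower (-2) = 7 / 8 := by norm_num [lower]

theorem lower_succ_of_nonneg {n : ℤ} (h : 0 ≤ n) : lower (n + 1) = lower n / 2 := by
  rcases h.eq_or_lt with rfl | h
  · norm_num [lower]
  · rw [lower_of_pos h, lower_of_pos (by omega), show -(n + 1) - 1 = -n - 1 - 1 by ring,
      zpow_sub_one₀ (by norm_num)]
    ring

theorem lower_succ_of_neg {n : ℤ} (h : n < 0) : lower (n + 1) = 2 * lower n - 1 := by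
  rw [lower_of_nonpos h.le, lower_of_nonpos (by omega), show n + 1 - 1 = n - 1 + 1 by ring,
    zpow_add_one₀ (by norm_num)]
  ring

/-- The labels at position `n` fill dyadic points of `[lower n, lower (n - 1))`; monotonicity makes
these intervals disjoint. -/
theorem lower_strictAnti : StrictAnti lower := by
  have hpos : ∀ n, 0 < lower n ∧ lower n < 1 := by
    intro n
    have h1 : (2 : ℝ) ^ (0 : ℤ) = 1 := zpow_zero _
    rcases lt_or_ge 0 n with h | h
    · rw [lower_of_pos h]
      exact ⟨by positivity, h1 ▸ zpow_lt_zpow_right₀ (by norm_num) (by omega)⟩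
    · rw [lower_of_nonpos h]
      have h2 : (2 : ℝ) ^ (n - 1) < 1 := h1 ▸ zpow_lt_zpow_right₀ (by norm_num) (by omega)
      have h3 : (0 : ℝ) < 2 ^ (n - 1) := by positivity
      constructor <;> linarith
  refine strictAnti_int_of_succ_lt fun n => ?_
  have h2 := hpos n
  rcases lt_or_ge n 0 with h | h
  · rw [lower_succ_of_neg h]
    linarith
  · rw [lower_succ_of_nonneg h]
    linarith

/-- The number whose binary expansion is the label of a vertex. -/
noncomputable def position (p : FinWord × ℤ) : ℝ :=
  lower p.2 + (lower (p.2 - 1) - lower p.2) * p.1.value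

theorem lower_le_position (p : FinWord × ℤ) : lower p.2 ≤ position p := by
  have h1 := p.1.value_mem
  have h2 : lower p.2 < lower (p.2 - 1) := lower_strictAnti (by omega)
  have h3 := mul_nonneg (sub_pos.2 h2).le h1.1
  rw [position]
  linarith

theorem position_lt_lower (p : FinWord × ℤ) : position p < lower (p.2 - 1) := by
  have h1 := p.1.value_mem
  have h2 : lower p.2 < lower (p.2 - 1) := lower_strictAnti (by omega)
  have h3 := mul_lt_mul_of_pos_left h1.2 (sub_pos.2 h2)
  rw [position]
  linarith

theorem position_injective : Function.Injective position := by
  have key : ∀ p p', position p = position p' → p.2 ≤ p'.2 := by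
    intro p p' h
    by_contra hlt
    have h1 : lower (p.2 - 1) ≤ lower p'.2 := lower_strictAnti.antitone (by omega)
    have h2 := position_lt_lower p
    have h3 := lower_le_position p'
    linarith
  rintro ⟨v, n⟩ ⟨v', n'⟩ h
  obtain rfl : n = n' := le_antisymm (key _ _ h) (key _ _ h.symm)
  have h1 : lower n < lower (n - 1) := lower_strictAnti (by omega)
  have h2 : (lower (n - 1) - lower n) * v.value = (lower (n - 1) - lower n) * v'.value := by
    simpa [position] using h
  rw [value_injective (mul_left_cancel₀ (sub_pos.2 h1).ne' h2)]

theorem position_mem (p : FinWord × ℤ) : position p ∈ unitInterval := by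
  have h1 := lower_le_position p
  have h2 := position_lt_lower p
  constructor
  · refine le_trans ?_ h1
    rw [lower]
    split_ifs with h
    · positivity
    · have : (2 : ℝ) ^ (p.2 - 1) ≤ 2 ^ (0 : ℤ) := zpow_le_zpow_right₀ (by norm_num) (by omega)
      rw [zpow_zero] at this
      linarith
  · refine h2.le.trans ?_
    rw [lower]
    split_ifs with h
    · have : (2 : ℝ) ^ (-(p.2 - 1) - 1) ≤ 2 ^ (0 : ℤ) :=
        zpow_le_zpow_right₀ (by norm_num) (by omega)
      rwa [zpow_zero] at this
    · have : (0 : ℝ) < 2 ^ (p.2 - 1 - 1) := by positivity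
      linarith

theorem position_zero (v : FinWord) : position (v, 0) = 1 / 2 + v.value / 4 := by
  rw [position, zero_sub, lower_zero, lower_neg_one]
  ring

theorem position_neg_one (v : FinWord) : position (v, -1) = 3 / 4 + v.value / 8 := by
  rw [position, show (-1 : ℤ) - 1 = -2 from rfl, lower_neg_one, lower_neg_two]
  ring

/-- The three pieces of `x₀` correspond to `n > 0`, `n = 0` and `n < 0`, and `x₀` carries the
interval of position `n` affinely to that of position `n + 1`. -/
theorem x0Fun_position (p : FinWord × ℤ) : x0Fun (position p) = position (p.1, p.2 + 1) := by
  obtain ⟨v, n⟩ := p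
  have h1 := lower_le_position (v, n)
  have h2 := position_lt_lower (v, n)
  simp only at h1 h2
  rcases lt_trichotomy n 0 with h | rfl | h
  · have h3 : lower (-1) ≤ lower n := lower_strictAnti.antitone (by omega)
    rw [lower_neg_one] at h3
    have h4 : position (v, n + 1) = 2 * position (v, n) - 1 := by
      have h5 := lower_succ_of_neg (n := n - 1) (by omega)
      rw [sub_add_cancel] at h5
      simp only [position, add_sub_cancel_right, lower_succ_of_neg h]
      rw [h5]
      ring
    rw [h4, x0Fun]
    split_ifs <;> linarith
  · have h4 : position (v, 0 + 1) = position (v, 0) - 1 / 4 := by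
      rw [position, position_zero]
      simp only [add_sub_cancel_right, lower_succ_of_nonneg le_rfl, lower_zero]
      ring
    rw [zero_sub, lower_neg_one] at h2
    rw [lower_zero] at h1
    rw [h4, x0Fun]
    split_ifs <;> linarith
  · have h3 : lower (n - 1) ≤ lower 0 := lower_strictAnti.antitone (by omega)
    rw [lower_zero] at h3
    have h4 : position (v, n + 1) = position (v, n) / 2 := by
      have h5 := lower_succ_of_nonneg (n := n - 1) (by omega)
      rw [sub_add_cancel] at h5
      simp only [position, add_sub_cancel_right, lower_succ_of_nonneg h.le]
      rw [h5]
      ring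
    rw [h4, x0Fun]
    split_ifs <;> linarith

/-- The four pieces of `x₁` correspond to `n > 0`, `n = 0`, `n = -1` and `n ≤ -2`. On the middle
two, `10v` becomes `100v` and `110v` becomes `101v`; on the last one, `x₁` agrees with `x₀`. -/
theorem x1Fun_position (p : FinWord × ℤ) :
    x1Fun (position p) = position (splitX1 splitEquiv p) := by
  obtain ⟨v, n⟩ := p
  have h1 := lower_le_position (v, n)
  have h2 := position_lt_lower (v, n)
  have hv := v.value_mem
  have hc : ∀ b, (splitEquiv.symm (b, v)).value = ((if b then 1 else 0) + v.value) / 2 :=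
    fun b => value_cons b v
  simp only at h1 h2
  rcases lt_trichotomy n 0 with h | rfl | h
  · rcases eq_or_ne n (-1) with rfl | hn
    · rw [splitX1_neg_one, position_neg_one, position_zero, hc, x1Fun]
      simp only [if_true]
      split_ifs <;> linarith
    · rw [splitX1_of_lt _ (by omega), ← x0Fun_position (v, n)]
      have h3 : lower (-2) ≤ lower n := lower_strictAnti.antitone (by omega)
      rw [lower_neg_two] at h3
      rw [x0Fun, x1Fun]
      split_ifs <;> linarith
  · rw [splitX1_zero, position_zero, position_zero, hc, x1Fun]
    simp only [Bool.false_eq_true, if_false]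
    split_ifs <;> linarith
  · rw [splitX1_of_pos _ h]
    have h3 : lower (n - 1) ≤ lower 0 := lower_strictAnti.antitone (by omega)
    rw [lower_zero] at h3
    rw [x1Fun]
    split_ifs <;> linarith

/-- The point of the unit interval with a given label. -/
noncomputable def point (p : FinWord × ℤ) : unitInterval := ⟨position p, position_mem p⟩

/-! ### The orbit of `1/2` in terms of binary labels -/

theorem gen_smul_point (s : Fin 2) (p : FinWord × ℤ) :
    gen s • point p = point ((![splitX0 FinWord, splitX1 splitEquiv] : Fin 2 → _) s p) := by
  apply Subtype.ext
  fin_cases s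
  · exact (x0Iso_apply _).trans (x0Fun_position p)
  · exact (x1Iso_apply _).trans (x1Fun_position p)

theorem point_mem_orbit (p : FinWord × ℤ) : point p ∈ MulAction.orbit thompsonF half := by
  have h := finWord_reach p.1 p.2
  refine Relation.ReflTransGen.head_induction_on (motive := fun (p : FinWord × ℤ) _ =>
    point p ∈ MulAction.orbit thompsonF half) h ?_ ?_
  · have : point (zero, 0) = half := by
      apply Subtype.ext
      change position (zero, 0) = 1 / 2
      rw [position_zero, value_zero]
      norm_num
    rw [this]
    exact MulAction.mem_orbit_self half
  · rintro p q ⟨s, hs | hs⟩ - hq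
    · replace hs : (![splitX0 FinWord, splitX1 splitEquiv] : Fin 2 → _) s p = q := hs
      rw [← hs, ← gen_smul_point] at hq
      simpa using MulAction.mem_orbit_of_mem_orbit (gen s)⁻¹ hq
    · replace hs : (![splitX0 FinWord, splitX1 splitEquiv] : Fin 2 → _) s q = p := hs
      rw [← hs, ← gen_smul_point]
      exact MulAction.mem_orbit_of_mem_orbit (gen s) hq

theorem point_injective : Function.Injective point := fun _ _ h =>
  position_injective (congrArg Subtype.val h)

/-- The points with labels are closed under the generators and their inverses, so connectedness of
the dyadic graph yields all of the orbit; binary expansions need not be constructed. -/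
theorem exists_point_eq (t : MulAction.orbit thompsonF half) : ∃ p, point p = t := by
  have h := dyadicGraph_connected (⟨point (zero, 0), point_mem_orbit _⟩ :
    MulAction.orbit thompsonF half) t
  refine Relation.ReflTransGen.rec (motive := fun (t : MulAction.orbit thompsonF half) _ =>
    ∃ p, point p = t) ⟨_, rfl⟩ ?_ h
  rintro t u - ⟨s, hs⟩ ⟨p, hp⟩
  rcases hs with hs | hs
  · replace hs : gen s • t = u := hs
    exact ⟨_, by rw [← hs, ← gen_smul_point, hp]; rfl⟩
  · replace hs : gen s • u = t := hs
    refine ⟨((![splitX0 FinWord, splitX1 splitEquiv] : Fin 2 → Equiv.Perm _) s).symm p, ?_⟩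
    refine MulAction.injective (gen s) ?_
    change gen s • point _ = gen s • u.1
    rw [gen_smul_point, Equiv.apply_symm_apply, hp, ← hs]
    rfl

/-- The vertices of the dyadic graph as vertices of the graph of a splitting. -/
noncomputable def pointEquiv : FinWord × ℤ ≃ MulAction.orbit thompsonF half :=
  Equiv.ofBijective (fun p => ⟨point p, point_mem_orbit p⟩)
    ⟨fun _ _ h => point_injective (congrArg Subtype.val h), fun t => by
      obtain ⟨p, hp⟩ := exists_point_eq t
      exact ⟨p, Subtype.ext hp⟩⟩

/-- The graph of type A pointed at the vertex with a given label. -/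
noncomputable def dyadicPt (p : FinWord × ℤ) : PointedGraph :=
  splitPt splitEquiv finWord_connected p.1 p.2

theorem dyadicPt_iso (p : FinWord × ℤ) :
    PointedGraph.Iso (dyadicPt p) ⟨dyadicGraph, dyadicGraph_connected, pointEquiv p⟩ := by
  refine ⟨pointEquiv, rfl, fun s (x y : FinWord × ℤ) => ?_⟩
  change (![splitX0 FinWord, splitX1 splitEquiv] : Fin 2 → _) s x = y ↔
    gen s • pointEquiv x = pointEquiv y
  have h : gen s • pointEquiv x =
      pointEquiv ((![splitX0 FinWord, splitX1 splitEquiv] : Fin 2 → _) s x) :=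
    Subtype.ext (gen_smul_point s x)
  rw [h, pointEquiv.apply_eq_iff_eq]

theorem typeA_eq : typeA = Set.range fun p => GraphSpace.mk (dyadicPt p) := by
  ext g
  constructor
  · rintro ⟨q, rfl⟩
    refine ⟨pointEquiv.symm q, GraphSpace.mk_eq_iff.2 ?_⟩
    have h := dyadicPt_iso (pointEquiv.symm q)
    rwa [pointEquiv.apply_symm_apply (q : MulAction.orbit thompsonF half)] at h
  · rintro ⟨p, rfl⟩
    exact ⟨pointEquiv p, GraphSpace.mk_eq_iff.2 (dyadicPt_iso p)⟩

/-! ### Graphs of type A far from the root -/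

theorem FinWord.exists_last {v : FinWord} {m : ℕ} (hm : v.1 m = true) :
    ∃ k, m ≤ k ∧ v.1 k = true ∧ ∀ i, k < i → v.1 i = false := by
  obtain ⟨N, hN⟩ := v.2
  have hmN : m ≤ N := by
    by_contra h
    simp [hN m (by omega)] at hm
  refine ⟨Nat.findGreatest (fun i => v.1 i = true) N, Nat.le_findGreatest hmN hm,
    Nat.findGreatest_spec (P := fun i => v.1 i = true) hmN hm, fun i hi => ?_⟩
  rcases le_total i N with h | h
  · simpa using Nat.findGreatest_is_greatest hi h
  · exact hN i h

/-- A vertex of the rootless tree is matched with its sequence of letters, its level being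
forgotten. Only a coincidence of sequences at different levels can spoil this, and a letter `1` of
`v` beyond position `r` prevents it near the base. -/
theorem dyadicPt_ballIso_treePt {v : FinWord} {r m : ℕ} (hm : v.1 m = true) (hr : r < m) (n : ℤ) :
    PointedGraph.BallIso r (dyadicPt (v, n)) (treePt v.1 n) := by
  obtain ⟨M, hmM, hM, hlast⟩ := v.exists_last hm
  -- Both sequences follow `v` from level `r + 1` on. The last `1` of `v`, at `M`, would be read as
  -- `1` from `τ`, but from the higher `τ'` the same index reads a letter of `v` beyond `M`, which
  -- is `0`.
  have key : ∀ τ τ' : Tree v.1, τ.1.2 = τ'.1.2 → τ.1.1 < τ'.1.1 → |τ.1.1| ≤ r + 1 →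
      (∀ i j : ℕ, r + 1 ≤ i → i = τ.1.1 + j → τ.1.2 j = v.1 i) →
      (∀ i j : ℕ, r + 1 ≤ i → i = τ'.1.1 + j → τ'.1.2 j = v.1 i) → False := by
    intro τ τ' h1 h2 h3 h4 h5
    rw [abs_le] at h3
    have h6 := h4 M (M - τ.1.1).toNat (by omega) (by omega)
    have h7 := h5 (τ'.1.1 + (M - τ.1.1)).toNat (M - τ.1.1).toNat (by omega) (by omega)
    rw [← h1, h6, hM, hlast _ (by omega)] at h7
    exact absurd h7 (by simp)
  refine splitPt_ballIso (e := splitEquiv) (e' := treeEquiv v.1) _ _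
    (P := fun k u τ => u.1 = τ.1.2 ∧ |τ.1.1| + k ≤ r + 1 ∧
      ∀ i j : ℕ, r + 1 ≤ i → i = τ.1.1 + j → τ.1.2 j = v.1 i) ?_ ?_ ?_ ?_ ?_ n
  · rintro k u τ ⟨h1, h2, h3⟩
    exact ⟨h1, by push_cast at h2; omega, h3⟩
  · rintro k b u τ ⟨h1, h2, h3⟩
    refine ⟨funext fun j => ?_, ?_, ?_⟩
    · cases j with
      | zero => rfl
      | succ j => exact congrFun h1 j
    · rw [treeEquiv_symm_level]
      have h4 := abs_sub τ.1.1 1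
      push_cast at h2
      rw [abs_one] at h4
      omega
    · rintro i (_ | j) hi hj
      · rw [treeEquiv_symm_level] at hj
        have h4 := le_abs_self τ.1.1
        push_cast at h2 hj
        omega
      · refine h3 i j hi ?_
        rw [treeEquiv_symm_level] at hj
        push_cast at hj
        omega
  · rintro k u τ ⟨h1, h2, h3⟩
    refine ⟨congrFun h1 0, funext fun j => congrFun h1 (j + 1), ?_, ?_⟩
    · simp only [treeEquiv, Equiv.coe_fn_mk, Tree.parent]
      have h4 := abs_add_le τ.1.1 1
      push_cast at h2
      rw [abs_one] at h4
      omega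
    · intro i j hi hj
      refine h3 i (j + 1) hi ?_
      simp only [treeEquiv, Equiv.coe_fn_mk, Tree.parent] at hj
      push_cast
      omega
  · rintro u τ u' τ' ⟨h1, h2, h3⟩ ⟨h1', h2', h3'⟩
    constructor
    · rintro rfl
      have h4 : τ.1.2 = τ'.1.2 := h1.symm.trans h1'
      refine Tree.ext ?_ h4
      rcases lt_trichotomy τ.1.1 τ'.1.1 with h | h | h
      · exact (key τ τ' h4 h (by simpa using h2) h3 h3').elim
      · exact h
      · exact (key τ' τ h4.symm h (by simpa using h2') h3' h3).elim
    · rintro rfl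
      exact Subtype.ext (h1.trans h1'.symm)
  · refine ⟨by simp [spine], by simp [spine], fun i j hi hij => ?_⟩
    obtain rfl : i = j := by simpa [spine] using hij
    simp [spine]

/-- For all but finitely many vertices, the ball of radius `r` is the ball of a graph of type B. -/
theorem finite_not_ballIso (r : ℕ) :
    {p : FinWord × ℤ | ¬ PointedGraph.BallIso r (dyadicPt p) (treePt p.1.1 p.2)}.Finite := by
  have hfin : {v : FinWord | ∀ i, r < i → v.1 i = false}.Finite := by
    refine Set.Finite.of_finite_image (f := fun v => fun i : Fin (r + 1) => v.1 i)
      (Set.toFinite _) fun v hv v' hv' h => ?_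
    refine Subtype.ext (funext fun i => ?_)
    rcases lt_or_ge r i with hi | hi
    · rw [hv i hi, hv' i hi]
    · exact congrFun h ⟨i, by omega⟩
  refine (hfin.prod (Set.finite_Icc (-(r + 2 : ℤ)) (r + 2))).subset ?_
  rintro ⟨v, n⟩ hp
  refine ⟨fun i hi => ?_, ?_⟩
  · by_contra h
    exact hp (dyadicPt_ballIso_treePt (by simpa using h) hi n)
  · by_contra h
    rw [Set.mem_Icc, not_and_or, not_le, not_le] at h
    refine hp ?_
    -- Far from the middle of the line, both balls are balls of the same graph of type C.
    rcases h with h | h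
    · have h' : n < -((r : ℤ) + 1) - 1 := by simp only at h; omega
      exact (splitPt_ballIso_linePt_one _ _ _ h').trans
        (splitPt_ballIso_linePt_one _ _ _ h').symm
    · have h' : (r : ℤ) + 1 < n := by simp only at h; omega
      exact (splitPt_ballIso_linePt_zero _ _ _ h').trans
        (splitPt_ballIso_linePt_zero _ _ _ h').symm

/-- The `x₁`-loop at the grey vertex `(zero, 0)`, the point `1/2`, survives in no graph of type B,
and a line is not the graph of a splitting. -/
theorem mk_dyadicPt_notMem (p : FinWord × ℤ) :
    GraphSpace.mk (dyadicPt p) ∉ Set.range decode := by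
  rintro ⟨x, hx⟩
  rcases code_cases x with ⟨v, n, h⟩ | h
  · rw [h.decode_eq, eq_comm, GraphSpace.mk_eq_iff] at hx
    exact not_iso_of_loop (treeEquiv_symm_ne v) splitEquiv_symm_zero hx
  · rw [decode_of_forall h, eq_comm, GraphSpace.mk_eq_iff] at hx
    refine not_iso_linePt ?_ hx
    split_ifs <;> simp

/-! ### Accumulation points -/

/-- The word that agrees with `x` before the position `m`, followed by `1000…`. -/
def truncate (x : ℕ → Bool) (m : ℕ) : ℕ → Bool := fun i => if i < m then x i else decide (i = m)

theorem truncate_self (x : ℕ → Bool) (m : ℕ) : truncate x m m = true := by simp [truncate]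

theorem truncate_of_lt (x : ℕ → Bool) {m i : ℕ} (h : m < i) : truncate x m i = false := by
  simp [truncate, h.not_gt, h.ne']

theorem truncate_injective (x : ℕ → Bool) : Function.Injective (truncate x) := by
  intro m m' h
  by_contra hne
  rcases Nat.lt_or_gt_of_ne hne with hlt | hlt
  · have h1 := truncate_self x m'
    rw [← h, truncate_of_lt x hlt] at h1
    exact absurd h1 (by simp)
  · have h1 := truncate_self x m
    rw [h, truncate_of_lt x hlt] at h1
    exact absurd h1 (by simp)

theorem tendsto_truncate (x : ℕ → Bool) : Tendsto (truncate x) atTop (𝓝 x) := by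
  refine tendsto_pi_nhds.2 fun i => tendsto_nhds_of_eventually_eq ?_
  filter_upwards [eventually_gt_atTop i] with m hm
  simp [truncate, hm]

theorem exists_isCode_truncate (x : ℕ → Bool) (m : ℕ) :
    ∃ p : FinWord × ℤ, IsCode (truncate x (m + 1)) p.1.1 p.2 := by
  -- Truncating at `m + 1` keeps the final `1` away from the sign letter, so that the result always
  -- encodes a pair.
  obtain ⟨v, n, h⟩ := exists_isCode_of_exists (x := truncate x (m + 1)) ⟨m, truncate_self x _⟩
  refine ⟨(⟨v, m + 2, fun i hi => ?_⟩, n), h⟩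
  rw [← h.word]
  exact truncate_of_lt x (by omega)

theorem perfect_range_decode : Perfect (Set.range decode) := by
  refine ⟨(isCompact_range continuous_decode).isClosed, ?_⟩
  refine preperfect_iff_nhds.2 ?_
  rintro _ ⟨x, rfl⟩ U hU
  have h1 : Tendsto (fun m => decode (truncate x m)) atTop (𝓝 (decode x)) :=
    (continuous_decode.tendsto x).comp (tendsto_truncate x)
  -- The truncations are distinct, so they eventually differ from `x`, and by injectivity their
  -- images differ from `decode x`.
  have h2 : Tendsto (truncate x) atTop (cofinite) :=
    Nat.cofinite_eq_atTop ▸ (truncate_injective x).tendsto_cofinite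
  obtain ⟨m, hm, hm'⟩ := ((h1.eventually_mem hU).and
    (h2.eventually (Set.finite_singleton x).compl_mem_cofinite)).exists
  exact ⟨_, ⟨hm, _, rfl⟩, decode_injective.ne hm'⟩

/-- The truncations of `x` encode pairs `(v, n)` that also label vertices of the Schreier graph.
These vertices are distinct, so for each `r` all but finitely many of them share their ball of
radius `r` with the graph of type B, and the graphs of type A have the same limit `decode x`. -/
theorem range_decode_subset_derivedSet : Set.range decode ⊆ derivedSet typeA := by
  rintro _ ⟨x, rfl⟩
  choose p hp using exists_isCode_truncate x
  have hinj : Function.Injective p := fun m m' h => by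
    have h1 := hp m
    rw [h] at h1
    have := truncate_injective x (h1.eq (hp m'))
    omega
  have h1 : Tendsto (fun m => GraphSpace.mk (treePt (p m).1.1 (p m).2)) atTop (𝓝 (decode x)) := by
    simp only [← (hp _).decode_eq]
    exact (continuous_decode.tendsto x).comp ((tendsto_truncate x).comp (tendsto_add_atTop_nat 1))
  have h2 : Tendsto p atTop cofinite := Nat.cofinite_eq_atTop ▸ hinj.tendsto_cofinite
  refine accPt_iff_nhds.2 fun U hU => ?_
  obtain ⟨ε, hε, hU⟩ := Metric.mem_nhds_iff.1 hU
  obtain ⟨r, hr⟩ := exists_pow_lt_of_lt_one (half_pos hε) (by norm_num : (1 / 2 : ℝ) < 1)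
  obtain ⟨m, hm, hm'⟩ := ((h1.eventually_mem (Metric.ball_mem_nhds _ (half_pos hε))).and
    (h2.eventually (finite_not_ballIso r).compl_mem_cofinite)).exists
  refine ⟨GraphSpace.mk (dyadicPt (p m)), ⟨hU ?_, ?_⟩, fun h => ?_⟩
  · have h3 : dist (GraphSpace.mk (dyadicPt (p m))) (GraphSpace.mk (treePt (p m).1.1 (p m).2)) ≤
        (1 / 2 : ℝ) ^ r := (GraphSpace.dist_le_iff _ _ r).2 (not_not.1 hm')
    have h4 := dist_triangle (GraphSpace.mk (dyadicPt (p m)))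
      (GraphSpace.mk (treePt (p m).1.1 (p m).2)) (decode x)
    rw [Metric.mem_ball] at hm ⊢
    linarith
  · rw [typeA_eq]
    exact ⟨_, rfl⟩
  · exact mk_dyadicPt_notMem (p m) ⟨x, h.symm⟩

/-- Conversely, a point `g` outside the closed set `Set.range decode` has a neighbourhood in which a
graph of type A cannot be close to its companion of type B. Only finitely many vertices are of this
kind, so `g` is not an accumulation point. -/
theorem derivedSet_typeA : derivedSet typeA = Set.range decode := by
  refine Set.Subset.antisymm (fun g hg => ?_) range_decode_subset_derivedSet
  by_contra hgD
  obtain ⟨ε, hε, hball⟩ := Metric.isOpen_iff.1 perfect_range_decode.closed.isOpen_compl g hgD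
  obtain ⟨r, hr⟩ := exists_pow_lt_of_lt_one (half_pos hε) (by norm_num : (1 / 2 : ℝ) < 1)
  refine Set.Infinite.of_accPt (AccPt.nhds_inter hg (Metric.ball_mem_nhds g (half_pos hε))) ?_
  refine ((finite_not_ballIso r).image fun p => GraphSpace.mk (dyadicPt p)).subset ?_
  rw [typeA_eq]
  rintro _ ⟨hp, p, rfl⟩
  refine ⟨p, fun h => ?_, rfl⟩
  have h3 : dist (GraphSpace.mk (dyadicPt p)) (GraphSpace.mk (treePt p.1.1 p.2)) ≤
      (1 / 2 : ℝ) ^ r := (GraphSpace.dist_le_iff _ _ r).2 h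
  have h4 := dist_triangle_left (GraphSpace.mk (treePt p.1.1 p.2)) g (GraphSpace.mk (dyadicPt p))
  obtain ⟨x, hx⟩ := exists_isCode p.1.1 p.2
  refine hball (a := GraphSpace.mk (treePt p.1.1 p.2)) ?_ ⟨x, hx.decode_eq⟩
  rw [Metric.mem_ball] at hp ⊢
  linarith

/-! ### Rank and perfect kernel -/

open CantorBendixson in
theorem iteratedDerivedSet_one : iteratedDerivedSet (closure typeA) 1 = Set.range decode := by
  have h : iteratedDerivedSet (closure typeA) (0 + 1) = _ := iteratedDerivedSet_succ
  rw [zero_add, iteratedDerivedSet_zero, isClosed_closure.relDerivedSet_eq, derivedSet_closure,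
    derivedSet_typeA] at h
  exact h

theorem cantorBendixsonRank_closure_typeA : cantorBendixsonRank (closure typeA) = 1 := by
  refine le_antisymm (csInf_le' ?_) (le_csInf ⟨1, ?_⟩ fun a ha => ?_)
  · rw [Set.mem_ofPred_eq, iteratedDerivedSet_one]
    exact perfect_range_decode.acc
  · rw [Set.mem_ofPred_eq, iteratedDerivedSet_one]
    exact perfect_range_decode.acc
  -- Rank `0` would put every graph of type A into the derived set, that is, into the image of
  -- `decode`.
  · rw [Order.one_le_iff_pos, pos_iff_ne_zero]
    rintro rfl
    rw [Set.mem_ofPred_eq, CantorBendixson.iteratedDerivedSet_zero,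
      preperfect_iff_subset_derivedSet, derivedSet_closure, derivedSet_typeA] at ha
    have hA : GraphSpace.mk (dyadicPt (zero, 0)) ∈ typeA := by
      rw [typeA_eq]
      exact ⟨_, rfl⟩
    exact mk_dyadicPt_notMem _ (ha (subset_closure hA))

theorem perfectKernel_closure_typeA :
    CantorBendixson.perfectKernel (closure typeA) = Set.range decode := by
  rw [CantorBendixson.perfectKernel_eq_iteratedDerivedSet_of_mem_fixedPoints (a := 1),
    iteratedDerivedSet_one]
  -- The derivation is already stationary at stage `1`, because a perfect set equals its relative
  -- derived set.
  rw [iteratedDerivedSet_one]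
  exact (preperfect_iff_eq_relDerivedSet.1 perfect_range_decode.acc).symm

end SchreierF

theorem mainTheorem4 :
    SchreierF.cantorBendixsonRank (closure SchreierF.typeA) = 1 ∧
    CantorBendixson.perfectKernel (closure SchreierF.typeA) = SchreierF.typeB ∪ SchreierF.typeC ∧
    Nonempty (CantorBendixson.perfectKernel (closure SchreierF.typeA) ≃ₜ (ℕ → Bool)) := by
  refine ⟨SchreierF.cantorBendixsonRank_closure_typeA, ?_, ?_⟩
  · rw [SchreierF.perfectKernel_closure_typeA, SchreierF.range_decode]
  · rw [SchreierF.perfectKernel_closure_typeA]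
    exact ⟨(SchreierF.continuous_decode.isClosedEmbedding
      SchreierF.decode_injective).isEmbedding.toHomeomorph.symm⟩
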